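/- **Setting.** There are messages $x_1,\dots,x_M$ (bit strings of a common length $b\ge 1$; $\oplus$ is bitwise XOR) and clients $1,\dots,C$. Client $i$ holds the messages with index in $\mathcal I_i\subseteq\{1,\dots,M\}$. The sets are *linearly progressive with fixed overlap* (LPS-FO) with parameters $K,P$, $P\le K$: each $\mathcal I_i$ consists of consecutive indices, $\mathcal I_1=\{1,\dots,K\}$, $|\mathcal I_i|=K+i-1$, and for $1\le i<C$ clients $i$ and $i+1$ share exactly $P$ messages, the last $P$ messages of $\mathcal I_i$ being the first $P$ messages of $\mathcal I_{i+1}$. Write $F^i_j$, $L^i_j$, $U^i_j$ for the $j$-th message among the first $P$ messages of client $i$, among its last $P$ messages, and among its unique messages (those held by no other client), and $U^i_{\rm last}$ for its last unique message. For an integer $n\ge1$ let $r_{\max}(n)$ be the positive integer $r$ with $\frac{(r-2)(r-1)}2<n\le\frac{r(r-1)}2$. **Scheme.** Start with all $C$ clients. At a level with $n$ remaining clients, renumbered $1,\dots,n$ in their original order, put $r=r_{\max}(n)$. * If $n\ge3$ and $n\ne\frac{(r-2)(r-1)}2+1$, put $t=\frac{(r-2)(r-3)}2$ and $d=n-r-t$.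 For $2\le k\le r-2$ client $k$ sends $F^k_1\oplus L^k_1$ and $F^k_1\oplus U^k_j$ $(1\le j\le k-2)$. Client $r-1$ sends $F^{r-1}_1\oplus L^{r-1}_1$, then $F^{r-1}_1\oplus U^{r-1}_j$ $(1\le j\le d)$, then $L^{r-1}_1\oplus L^{r-1}_{j-d+1}$ $(d+1\le j\le r-3)$. Client $r$ sends $F^r_1\oplus U^r_j$ $(1\le j\le d+2)$. * If $n\ge3$ and $n=\frac{(r-2)(r-1)}2+1$, put $t=\frac{(r-3)(r-4)}2+1$. Client $2$ sends $F^2_1\oplus F^2_2\oplus L^2_1$. For $3\le k\le r-2$ client $k$ sends $F^k_1\oplus L^k_1$ and $F^k_1\oplus U^k_j$ $(1\le j\le k-3)$. Client $r-1$ sends $F^{r-1}_1\oplus L^{r-1}_1$ and $L^{r-1}_1\oplus U^{r-1}_j$ $(1\le j\le r-4)$. Client $r$ sends $F^r_1\oplus U^r_j$ $(1\le j\le n-r-t+3)$. * In both cases remove the first $r$ clients and repeat with the remaining $n-r$. * If $n=2$, client $2$ sends $F^2_1\oplus U^2_1$ and $F^2_1\oplus U^2_2$, client $1$ sends $L^1_1\oplus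 U^1_1$, and the scheme stops. * If $n=1$, client $C-1$ of the original numbering sends $L^{C-1}_1\oplus U^{C-1}_{\rm last}$, and the scheme stops. If $n=0$, it stops. **Theorem.** Let the side-information sets be LPS-FO with $C\ge3$, $K\ge2P$ and $P\ge r_{\max}-2$, where $r_{\max}=r_{\max}(C)$. Then every transmission of the scheme is an XOR of messages from its sender's own side-information set. After the delivery every client possesses exactly $T=K+C$ messages: for each client, exactly $K+C$ of the messages $x_1,\dots,x_M$ (its side information included) can be recovered by some decoding function from its side information and all transmissions. The number of transmissions is $N(C)$, where $N(0)=0$, $N(1)=1$, $N(2)=3$ and $N(n)=n+N(n-r_{\max}(n))$ for all $n\ge3$; in particular $N(C)=C+N(C-r_{\max})$. -/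

import Mathlib

namespace SecureDPIC

/-! ### Side-information sets

Messages are `x_1, …, x_M`, clients are `1, …, C`; both are referred to by their index, and
`I i` is the set of (indices of) messages that client `i` holds at the start. -/

/-- `A[j]`: the `j`-th smallest element of `A`, for `1 ≤ j ≤ |A|`. (The default value `0` is not
the index of a message.) -/
def nth (A : Finset ℕ) (j : ℕ) : ℕ := (A.sort (· ≤ ·)).getD (j - 1) 0

/-- The first (smallest) `P` messages of `A`: those with fewer than `P` smaller ones in `A`. -/
def firstMsgs (P : ℕ) (A : Finset ℕ) : Finset ℕ := A.filter (fun m => (A.filter (fun k => k < m)).card < P)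

/-- The last (largest) `P` messages of `A`: those with fewer than `P` larger ones in `A`. -/
def lastMsgs (P : ℕ) (A : Finset ℕ) : Finset ℕ := A.filter (fun m => (A.filter (fun k => m < k)).card < P)

/-- Linearly progressive sets with fixed overlap: `M` messages, `C` clients, the first client has
`K` messages, and consecutive clients share exactly `P` messages. -/
structure IsLPSFO (M C K P : ℕ) (I : ℕ → Finset ℕ) : Prop where
  /-- the side-information sets consist of messages -/
  subset_messages : ∀ i ∈ Finset.Icc 1 C, I i ⊆ Finset.Icc 1 M
  /-- the messages in each side-information set are consecutive -/
  consecutive : ∀ i ∈ Finset.Icc 1 C, ∃ a b, I i = Finset.Icc a b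
  first_client : I 1 = Finset.Icc 1 K
  card_eq : ∀ i ∈ Finset.Icc 1 C, (I i).card = K + (i - 1)
  overlap_le : P ≤ K
  card_overlap : ∀ i ∈ Finset.Icc 1 (C - 1), (I i ∩ I (i + 1)).card = P
  last_eq_first : ∀ i ∈ Finset.Icc 1 (C - 1), lastMsgs P (I i) = firstMsgs P (I (i + 1))

/-- `I_{F_j}^i`: the `j`-th message of the initial overlapping segment (first `P` messages). -/
def msgF (P : ℕ) (I : ℕ → Finset ℕ) (i j : ℕ) : ℕ := nth (firstMsgs P (I i)) j

/-- `I_{L_j}^i`: the `j`-th message of the terminal overlapping segment (last `P` messages). -/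
def msgL (P : ℕ) (I : ℕ → Finset ℕ) (i j : ℕ) : ℕ := nth (lastMsgs P (I i)) j

/-- The unique messages of client `i`: those that no other client has as side information. -/
def uniqueMsgs (C : ℕ) (I : ℕ → Finset ℕ) (i : ℕ) : Finset ℕ :=
  I i \ ((Finset.Icc 1 C).erase i).biUnion I

/-- `I_{U_j}^i`: the `j`-th unique message of client `i`. -/
def msgU (C : ℕ) (I : ℕ → Finset ℕ) (i j : ℕ) : ℕ := nth (uniqueMsgs C I i) j

/-- `I_{U_L}^i`: the last unique message of client `i`. -/
def msgULast (C : ℕ) (I : ℕ → Finset ℕ) (i : ℕ) : ℕ :=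
  nth (uniqueMsgs C I i) (uniqueMsgs C I i).card

/-! ### Transmissions and decoding -/

/-- The content of a message: a string of `b` bits. Addition is bitwise XOR. -/
abbrev Bits (b : ℕ) : Type := Fin b → ZMod 2

/-- A coded transmission: the broadcasting client and the messages whose XOR it broadcasts. -/
structure Transmission where
  sender : ℕ
  terms : List ℕ

/-- The bit string that is broadcast when the messages have contents `x`. -/
def Transmission.value {b : ℕ} (x : ℕ → Bits b) (w : Transmission) : Bits b :=
  (w.terms.map x).sum

/-- A scheme can be carried out in a decentralized way: every transmission is broadcast by one of
the clients and is an XOR of messages from that client's own side-information set. -/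
def IsDecentralized (C : ℕ) (I : ℕ → Finset ℕ) (W : List Transmission) : Prop :=
  ∀ w ∈ W, w.sender ∈ Finset.Icc 1 C ∧ ∀ m ∈ w.terms, m ∈ I w.sender

/-- Message `m` can be recovered, by some decoding function (of any kind), from the messages in
`S` and all transmissions of the scheme `W`. This includes the messages `m ∈ S`. -/
def CanDecode (b : ℕ) (S : Finset ℕ) (W : List Transmission) (m : ℕ) : Prop :=
  ∃ D : (S → Bits b) → List (Bits b) → Bits b,
    ∀ x : ℕ → Bits b, D (fun s => x s) (W.map (Transmission.value x)) = x m

/-- All messages that a client with side information `S` possesses after the delivery. -/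
def finalKnowledge (b M : ℕ) (S : Finset ℕ) (W : List Transmission) : Set ℕ :=
  {m | m ∈ Finset.Icc 1 M ∧ CanDecode b S W m}

/-- Security: after the delivery, every client possesses exactly `T` messages, no more. -/
def IsSecure (b M C T : ℕ) (I : ℕ → Finset ℕ) (W : List Transmission) : Prop :=
  ∀ i ∈ Finset.Icc 1 C, (finalKnowledge b M (I i) W).ncard = T

/-! ### The parameter `r_max` -/

/-- `r` is a positive integer with `(r-2)(r-1)/2 < C ≤ r(r-1)/2`. -/
def IsRMax (C r : ℕ) : Prop :=
  0 < r ∧ ((r : ℤ) - 2) * ((r : ℤ) - 1) / 2 < (C : ℤ) ∧ (C : ℤ) ≤ (r : ℤ) * ((r : ℤ) - 1) / 2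

instance (C r : ℕ) : Decidable (IsRMax C r) := by unfold IsRMax; infer_instance

theorem exists_isRMax {C : ℕ} (hC : 0 < C) : ∃ r, IsRMax C r := by
  have hex : ∃ r : ℕ, 0 < r ∧ (C : ℤ) ≤ (r : ℤ) * ((r : ℤ) - 1) / 2 := by
    refine ⟨C + 1, Nat.succ_pos _, ?_⟩
    rw [Int.le_ediv_iff_mul_le (by norm_num)]
    push_cast
    nlinarith [(by exact_mod_cast hC : (1 : ℤ) ≤ C)]
  classical
  obtain ⟨h0, h1⟩ := Nat.find_spec hex
  refine ⟨Nat.find hex, h0, ?_, h1⟩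
  by_contra hlt
  rcases Nat.lt_or_ge (Nat.find hex) 2 with h | h
  · have h' : Nat.find hex = 1 := by omega
    rw [h'] at hlt
    norm_num at hlt
    omega
  · refine Nat.find_min hex (m := Nat.find hex - 1) (by omega) ⟨by omega, ?_⟩
    push_cast [Nat.cast_sub (show 1 ≤ Nat.find hex by omega)]
    have e : ((Nat.find hex : ℤ) - 1) * ((Nat.find hex : ℤ) - 1 - 1)
        = ((Nat.find hex : ℤ) - 2) * ((Nat.find hex : ℤ) - 1) := by ring
    rw [e]
    exact not_lt.mp hlt

/-- The integer `r_max` of `C` clients. -/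
def rMax (C : ℕ) : ℕ := if h : 0 < C then Nat.find (exists_isRMax h) else 0

theorem rMax_spec {C : ℕ} (hC : 0 < C) : IsRMax C (rMax C) := by
  rw [rMax, dif_pos hC]
  exact Nat.find_spec (exists_isRMax hC)

/-! ### The transmission scheme

At a recursive level there are `n` clients left, and the `i`-th of them is client `o + i` of the
original problem. `r` is the `r_max` of `n`. -/

/-- `[a, a+1, …, b]`, empty for `b < a`. -/
def upTo (a b : ℕ) : List ℕ := List.range' a (b + 1 - a)

/-- The general case, used for `n ≠ (r-2)(r-1)/2 + 1`. -/
def generalCase (C P : ℕ) (I : ℕ → Finset ℕ) (o n r : ℕ) : List Transmission :=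
  let F := fun i j => msgF P I (o + i) j
  let L := fun i j => msgL P I (o + i) j
  let U := fun i j => msgU C I (o + i) j
  let send := fun (i : ℕ) (t : List ℕ) => Transmission.mk (o + i) t
  let T := (r - 2) * (r - 3) / 2
  let d := n - r - T
  -- phase 1: clients 2, …, r - 2
  ((upTo 1 (r - 3)).flatMap fun i =>
      send (i + 1) [F (i + 1) 1, L (i + 1) 1] ::
        (upTo 1 (i - 1)).map fun j => send (i + 1) [F (i + 1) 1, U (i + 1) j])
  -- phase 2: client r - 1
  ++ [send (r - 1) [F (r - 1) 1, L (r - 1) 1]]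
  ++ ((upTo 1 d).map fun j => send (r - 1) [F (r - 1) 1, U (r - 1) j])
  ++ ((upTo (d + 1) (r - 3)).map fun j => send (r - 1) [L (r - 1) 1, L (r - 1) (j - d + 1)])
  -- phase 3: client r
  ++ ((upTo 1 (d + 2)).map fun j => send r [F r 1, U r j])

/-- The special case, used for `n = (r-2)(r-1)/2 + 1`. -/
def specialCase (C P : ℕ) (I : ℕ → Finset ℕ) (o n r : ℕ) : List Transmission :=
  let F := fun i j => msgF P I (o + i) j
  let L := fun i j => msgL P I (o + i) j
  let U := fun i j => msgU C I (o + i) j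
  let send := fun (i : ℕ) (t : List ℕ) => Transmission.mk (o + i) t
  let T := (r - 3) * (r - 4) / 2 + 1
  -- phase 1: clients 2, …, r - 2
  [send 2 [F 2 1, F 2 2, L 2 1]]
  ++ ((upTo 1 (r - 4)).flatMap fun i =>
      send (i + 2) [F (i + 2) 1, L (i + 2) 1] ::
        (upTo 1 (i - 1)).map fun j => send (i + 2) [F (i + 2) 1, U (i + 2) j])
  -- phase 2: client r - 1
  ++ [send (r - 1) [F (r - 1) 1, L (r - 1) 1]]
  ++ ((upTo 1 (r - 4)).map fun j => send (r - 1) [L (r - 1) 1, U (r - 1) j])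
  -- phase 3: client r; the count n - r - T + 3 is written so that subtraction does not truncate
  ++ ((upTo 1 (n + 3 - r - T)).map fun j => send r [F r 1, U r j])

/-- The recursion, started with the `n` clients `o + 1, …, o + n` of the original `C`. -/
def schemeFrom (C P : ℕ) (I : ℕ → Finset ℕ) (o n : ℕ) : List Transmission :=
  if h : 2 < n then
    (if n ≠ (rMax n - 2) * (rMax n - 1) / 2 + 1 then generalCase C P I o n (rMax n)
      else specialCase C P I o n (rMax n))
    ++ schemeFrom C P I (o + rMax n) (n - rMax n)
  else if n = 2 then
    [⟨o + 2, [msgF P I (o + 2) 1, msgU C I (o + 2) 1]⟩,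
     ⟨o + 2, [msgF P I (o + 2) 1, msgU C I (o + 2) 2]⟩,
     ⟨o + 1, [msgL P I (o + 1) 1, msgU C I (o + 1) 1]⟩]
  else if n = 1 then
    [⟨C - 1, [msgL P I (C - 1) 1, msgULast C I (C - 1)]⟩]
  else []
termination_by n
decreasing_by
  have := (rMax_spec (C := n) (by omega)).1
  omega

/-- The complete recursive transmission scheme for `C` clients. -/
def scheme (C P : ℕ) (I : ℕ → Finset ℕ) : List Transmission := schemeFrom C P I 0 C

/-- `N(C)`: `N(0) = 0`, `N(1) = 1`, `N(2) = 3`, and `N(C) = C + N(C - r_max)` for `C ≥ 3`. -/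
def numTransmissions (n : ℕ) : ℕ :=
  if _h : 2 < n then n + numTransmissions (n - rMax n)
  else if n = 2 then 3 else if n = 1 then 1 else 0
termination_by n
decreasing_by
  have := (rMax_spec (C := n) (by omega)).1
  omega

end SecureDPIC

/-!
The effect of the scheme on each client is computed exactly.

A message can be recovered by an arbitrary decoding function if and only if it is linearly
determined: every assignment `f : ℕ → ZMod 2` that vanishes on the side information and on which all
transmissions vanish, vanishes at this message (`canDecode_iff_isDetermined`). Batches of
transmissions about disjoint sets of messages can be analysed separately (`isDetermined_append`), and
the levels of the recursion are separated by a threshold because the side-information sets are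
consecutive intervals.

The transmissions of a general level with `n` clients are the `n` edges of a tree on a set `V` of
`n + 1` messages: a path through the first messages of the clients `2, …, r`, with a star at each
of them. Such a tree says that `f` is constant on `V`, so a client holding `k ≥ 1` messages of
`V` learns exactly the other `n + 1 - k`, and a client holding none learns nothing
(`isDetermined_of_component`). The scheme is built so that the `k`-th client of the level holds
exactly `k` messages of `V`, for `1 ≤ k ≤ r`, and all other clients hold none (`learns_generalList`).
In the special case the tree has `n` vertices and is tied by one three-term transmission to the sum of
two messages that only the first two clients hold; this makes up for the vertex that the `k`-th client
lacks (`isDetermined_of_component_pair`, `learns_specialList`). The levels with one or two clients are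
components as well.

So client `i` learns exactly `C + 1 - i` messages, all of them in its own level, and it started with
`K + i - 1`. If a single client is left over, the last
unique message of its predecessor has not been used before: this happens only after a level that
begins with five clients, and in it the predecessor uses two of at least three unique messages.
-/

namespace SecureDPIC

/-! ### Decoding as a linear condition over `ZMod 2` -/

/-- Message `m` is determined by the messages in `S` and the transmissions `W`: every `0`-`1`
assignment that is compatible with all-zero side information and all-zero transmissions
vanishes at `m`. This is linear decodability, stated for the dual space. -/
def IsDetermined (S : Finset ℕ) (W : List Transmission) (m : ℕ) : Prop :=
  ∀ f : ℕ → ZMod 2, (∀ s ∈ S, f s = 0) → (∀ w ∈ W, (w.terms.map f).sum = 0) → f m = 0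

theorem Transmission.value_apply {b : ℕ} (x : ℕ → Bits b) (w : Transmission) (j : Fin b) :
    w.value x j = (w.terms.map fun n => x n j).sum := by
  have h := map_list_sum (Pi.evalAddMonoidHom (fun _ : Fin b => ZMod 2) j) (w.terms.map x)
  simpa [Transmission.value, List.map_map, Function.comp_def] using h

/-- Arbitrary decoding functions are no stronger than linear ones: two message vectors that a
client cannot tell apart differ by a vector that is invisible to it. -/
theorem canDecode_iff_isDetermined {b : ℕ} (hb : 0 < b) (S : Finset ℕ) (W : List Transmission)
    (m : ℕ) : CanDecode b S W m ↔ IsDetermined S W m := by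
  constructor
  · rintro ⟨D, hD⟩ f hS hW
    have h1 := hD fun n _ => f n
    have h2 := hD 0
    have e1 : (fun s : S => (fun (n : ℕ) (_ : Fin b) => f n) s)
        = fun s : S => (0 : ℕ → Bits b) s := by
      funext s j
      exact hS s s.2
    have e2 : W.map (Transmission.value fun (n : ℕ) (_ : Fin b) => f n)
        = W.map (Transmission.value (0 : ℕ → Bits b)) := by
      refine List.map_congr_left fun w hw => ?_
      funext j
      rw [Transmission.value_apply, Transmission.value_apply, hW w hw]
      simp
    rw [e1, e2, h2] at h1
    exact (congrFun h1 ⟨0, hb⟩).symm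
  · intro h
    classical
    refine ⟨fun u v => if hx : ∃ x : ℕ → Bits b,
      (fun s : S => x s) = u ∧ W.map (Transmission.value x) = v then hx.choose m else 0, ?_⟩
    intro x
    have hx : ∃ y : ℕ → Bits b, (fun s : S => y s) = (fun s : S => x s) ∧
        W.map (Transmission.value y) = W.map (Transmission.value x) := ⟨x, rfl, rfl⟩
    dsimp only
    rw [dif_pos hx]
    obtain ⟨h1, h2⟩ := hx.choose_spec
    generalize hx.choose = y at h1 h2
    funext j
    refine sub_eq_zero.mp (h (fun n => y n j - x n j) ?_ ?_)
    · intro s hs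
      have := congrFun (congrFun h1 ⟨s, hs⟩) j
      simpa [sub_eq_zero] using this
    · intro w hw
      have := congrFun (List.map_inj_left.mp h2 w hw) j
      rw [Transmission.value_apply, Transmission.value_apply] at this
      have hsub := Multiset.sum_map_sub (m := (w.terms : Multiset ℕ)) (f := fun n => y n j)
        (g := fun n => x n j)
      simp only [Multiset.map_coe, Multiset.sum_coe] at hsub
      rw [hsub, this, sub_self]

theorem isDetermined_nil (S : Finset ℕ) (m : ℕ) : IsDetermined S [] m ↔ m ∈ S := by
  constructor
  · intro h
    by_contra hm
    have := h (fun n => if n = m then 1 else 0)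
      (fun s hs => if_neg (ne_of_mem_of_not_mem hs hm)) (by simp)
    simp at this
  · intro h f hS _
    exact hS m h

/-- Only messages that occur in the transmissions are learned. -/
theorem IsDetermined.mem_or_mem_terms {S : Finset ℕ} {W : List Transmission} {m : ℕ}
    (h : IsDetermined S W m) : m ∈ S ∨ ∃ w ∈ W, m ∈ w.terms := by
  by_contra! hm
  have := h (fun n => if n = m then 1 else 0)
    (fun s hs => if_neg (ne_of_mem_of_not_mem hs hm.1)) (by
    intro w hw
    refine List.sum_eq_zero fun y hy => ?_
    obtain ⟨n, hn, rfl⟩ := List.mem_map.mp hy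
    exact if_neg (ne_of_mem_of_not_mem hn (hm.2 w hw)))
  simp at this

/-- Two batches of transmissions about disjoint sets of messages (here separated by a threshold
`t`) can be decoded separately. -/
theorem isDetermined_append {S : Finset ℕ} {A B : List Transmission} {t : ℕ}
    (hA : ∀ w ∈ A, ∀ n ∈ w.terms, n < t) (hB : ∀ w ∈ B, ∀ n ∈ w.terms, t ≤ n) (m : ℕ) :
    IsDetermined S (A ++ B) m ↔ IsDetermined S A m ∨ IsDetermined S B m := by
  constructor
  · intro h
    by_contra! hm
    simp only [IsDetermined, not_forall] at hm
    obtain ⟨⟨f, fS, fA, fm⟩, g, gS, gB, gm⟩ := hm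
    -- the invisible assignment on the side of the threshold where `m` lies, and `0` beyond
    rcases lt_or_ge m t with hmt | hmt
    · have := h (fun n => if n < t then f n else 0) (fun s hs => by simp [fS s hs]) (by
        intro w hw
        rcases List.mem_append.mp hw with hw | hw
        · rw [← fA w hw]
          exact congrArg _ (List.map_congr_left fun n hn => if_pos (hA w hw n hn))
        · refine List.sum_eq_zero fun y hy => ?_
          obtain ⟨n, hn, rfl⟩ := List.mem_map.mp hy
          exact if_neg (hB w hw n hn).not_gt)
      exact fm (by simpa [hmt] using this)
    · have := h (fun n => if t ≤ n then g n else 0) (fun s hs => by simp [gS s hs]) (by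
        intro w hw
        rcases List.mem_append.mp hw with hw | hw
        · refine List.sum_eq_zero fun y hy => ?_
          obtain ⟨n, hn, rfl⟩ := List.mem_map.mp hy
          exact if_neg (hA w hw n hn).not_ge
        · rw [← gB w hw]
          exact congrArg _ (List.map_congr_left fun n hn => if_pos (hB w hw n hn)))
      exact gm (by simpa [hmt] using this)
  · rintro (h | h) f hS hW
    · exact h f hS fun w hw => hW w (List.mem_append_left _ hw)
    · exact h f hS fun w hw => hW w (List.mem_append_right _ hw)

/-- If the transmissions say exactly that all messages of `V` are equal up to known differences,
then a client learns all of `V` or nothing, depending on whether it holds a message of `V`. -/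
theorem isDetermined_of_component {S V : Finset ℕ} {A : List Transmission} {ρ : ℕ} (hρ : ρ ∈ V)
    (hA : ∀ f : ℕ → ZMod 2, (∀ w ∈ A, (w.terms.map f).sum = 0) ↔ ∀ v ∈ V, f v = f ρ) (m : ℕ) :
    IsDetermined S A m ↔ m ∈ S ∨ (m ∈ V ∧ ∃ v ∈ V, v ∈ S) := by
  constructor
  · intro h
    by_contra! hm
    obtain ⟨hmS, hm⟩ := hm
    by_cases hmV : m ∈ V
    · have := h (fun n => if n ∈ V then 1 else 0)
        (fun s hs => if_neg fun hV => hm hmV s hV hs)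
        ((hA _).mpr fun v hv => by simp [hv, hρ])
      simp [hmV] at this
    · have := h (fun n => if n = m then 1 else 0) (fun s hs => if_neg (ne_of_mem_of_not_mem hs hmS))
        ((hA _).mpr fun v hv => by
          rw [if_neg (ne_of_mem_of_not_mem hv hmV), if_neg (ne_of_mem_of_not_mem hρ hmV)])
      simp at this
  · rintro (h | ⟨h, v, hv, hvS⟩) f hS hW
    · exact hS m h
    · have := (hA f).mp hW
      rw [this m h, ← this v hv, hS v hvS]

/-- The variant of `isDetermined_of_component` in which the component `V` is moreover tied to the
sum of two outside messages `p` and `q`, which every client holds both or not at all. Holding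
`p` and `q` is as good as holding a message of `V`, but neither of them is ever learned. -/
theorem isDetermined_of_component_pair {S V : Finset ℕ} {A : List Transmission} {ρ p q : ℕ}
    (hρ : ρ ∈ V) (hp : p ∉ V) (hq : q ∉ V) (hpq : p ≠ q) (hS : p ∈ S ↔ q ∈ S)
    (hA : ∀ f : ℕ → ZMod 2, (∀ w ∈ A, (w.terms.map f).sum = 0) ↔
      (∀ v ∈ V, f v = f ρ) ∧ f p + f q = f ρ) (m : ℕ) :
    IsDetermined S A m ↔ m ∈ S ∨ (m ∈ V ∧ (p ∈ S ∨ ∃ v ∈ V, v ∈ S)) := by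
  have hρp : ρ ≠ p := fun e => hp (e ▸ hρ)
  have hρq : ρ ≠ q := fun e => hq (e ▸ hρ)
  constructor
  · intro h
    by_contra! hm
    obtain ⟨hmS, hm⟩ := hm
    by_cases hmV : m ∈ V
    · obtain ⟨hpS, hm⟩ := hm hmV
      have := h (fun n => if n ∈ V ∨ n = p then 1 else 0)
        (fun s hs => if_neg fun hV => hV.elim (fun hV => hm s hV hs) fun e => hpS (e ▸ hs))
        ((hA _).mpr ⟨fun v hv => by simp [hv, hρ], by simp [hρ, hpq.symm, hq]⟩)
      simp [hmV] at this
    · by_cases hmpq : m = p ∨ m = q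
      · have hpS : p ∉ S ∧ q ∉ S := by
          rcases hmpq with rfl | rfl
          · exact ⟨hmS, fun hq' => hmS (hS.mpr hq')⟩
          · exact ⟨fun hp' => hmS (hS.mp hp'), hmS⟩
        have := h (fun n => if n = p ∨ n = q then 1 else 0)
          (fun s hs => if_neg fun e => e.elim (fun e => hpS.1 (e ▸ hs)) fun e => hpS.2 (e ▸ hs))
          ((hA _).mpr ⟨fun v hv => by
            rw [if_neg (by rintro (rfl | rfl) <;> contradiction), if_neg (by simp [hρp, hρq])], by
            simp only [true_or, or_true, if_true, hρp, hρq, or_self, if_false]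
            decide⟩)
        simp [hmpq] at this
      · push Not at hmpq
        have := h (fun n => if n = m then 1 else 0) (fun s hs => if_neg (ne_of_mem_of_not_mem hs hmS))
          ((hA _).mpr ⟨fun v hv => by
            rw [if_neg (ne_of_mem_of_not_mem hv hmV), if_neg (ne_of_mem_of_not_mem hρ hmV)], by
            rw [if_neg hmpq.1.symm, if_neg hmpq.2.symm, if_neg (ne_of_mem_of_not_mem hρ hmV), add_zero]⟩)
        simp at this
  · rintro (h | ⟨h, hv⟩) f hf hW
    · exact hf m h
    · obtain ⟨h1, h2⟩ := (hA f).mp hW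
      rw [h1 m h]
      rcases hv with hv | ⟨v, hv, hvS⟩
      · rw [← h2, hf p hv, hf q (hS.mp hv), add_zero]
      · rw [← h1 v hv, hf v hvS]

/-! ### Positions of the messages -/

/-- The smallest message of client `k`, for `k ≥ 1` (the value at `0` is irrelevant). It is defined
past the last client, so that client `k` holds exactly the messages from `start K P k` up to, but
not including, `start K P (k + 1) + P`. -/
def start (K P : ℕ) : ℕ → ℕ
  | 0 => 1
  | 1 => 1
  | k + 2 => start K P (k + 1) + (K + k - P)

theorem start_succ {K P k : ℕ} (hPK : P ≤ K) (hk : 1 ≤ k) :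
    start K P (k + 1) + P + 1 = start K P k + K + k := by
  obtain ⟨k, rfl⟩ : ∃ j, k = j + 1 := ⟨k - 1, by omega⟩
  simp only [start]
  omega

theorem start_mono {K P : ℕ} : Monotone (start K P) := by
  refine monotone_nat_of_le_succ fun k => ?_
  rcases k with _ | k
  · simp [start]
  · simp [start]

/-- The part of client `k`'s messages before the next client's first message has room for the
overlap and at least `k - 1` more messages. -/
theorem start_add_le {K P k : ℕ} (hK : 2 * P ≤ K) (hk : 1 ≤ k) :
    start K P k + P + k ≤ start K P (k + 1) + 1 := by
  have := start_succ (K := K) (P := P) (by omega) hk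
  omega

theorem nth_Ico {a b j : ℕ} (hj : 1 ≤ j) (hjb : a + j ≤ b) : nth (Finset.Ico a b) j = a + j - 1 := by
  have hs : (Finset.Ico a b).sort (· ≤ ·) = List.range' a (b - a) := by
    refine List.Perm.eq_of_sortedLE (Finset.sortedLT_sort _).sortedLE
      (List.sortedLT_range' _ _ one_ne_zero).sortedLE ?_
    refine (List.perm_ext_iff_of_nodup (Finset.sort_nodup _ _) List.nodup_range').mpr fun x => ?_
    rw [Finset.mem_sort, Finset.mem_Ico, List.mem_range'_1]
    omega
  rw [nth, hs, List.getD_eq_getElem _ _ (by rw [List.length_range']; omega), List.getElem_range']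
  omega

theorem firstMsgs_Ico {P a b : ℕ} (h : a + P ≤ b) :
    firstMsgs P (Finset.Ico a b) = Finset.Ico a (a + P) := by
  ext m
  rw [firstMsgs, Finset.mem_filter, Finset.Ico_filter_lt, Nat.card_Ico, Finset.mem_Ico,
    Finset.mem_Ico]
  omega

theorem lastMsgs_Ico {P a b : ℕ} (h : a + P ≤ b) :
    lastMsgs P (Finset.Ico a b) = Finset.Ico (b - P) b := by
  ext m
  have : ∀ m, a ≤ m → (Finset.Ico a b).filter (fun k => m < k) = Finset.Ico (m + 1) b := by
    intro m hm
    ext k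
    simp only [Finset.mem_filter, Finset.mem_Ico]
    omega
  rw [lastMsgs, Finset.mem_filter, Finset.mem_Ico, Finset.mem_Ico]
  constructor
  · rintro ⟨⟨h1, h2⟩, h3⟩
    rw [this m h1, Nat.card_Ico] at h3
    omega
  · rintro ⟨h1, h2⟩
    rw [this m (by omega), Nat.card_Ico]
    omega

section Positions

variable {M C K P : ℕ} {I : ℕ → Finset ℕ}

theorem IsLPSFO.eq_Ico (hI : IsLPSFO M C K P I) (hP : 1 ≤ P) (hK : 2 * P ≤ K) {i : ℕ}
    (hi : 1 ≤ i) (hiC : i ≤ C) :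
    I i = Finset.Ico (start K P i) (start K P (i + 1) + P) := by
  induction i, hi using Nat.le_induction with
  | base =>
    rw [hI.first_client]
    ext m
    simp only [Finset.mem_Icc, Finset.mem_Ico, start]
    omega
  | succ i hi ih =>
    have ih := ih (by omega)
    obtain ⟨a, b, hab⟩ := hI.consecutive (i + 1) (Finset.mem_Icc.mpr ⟨by omega, hiC⟩)
    have hcard := hI.card_eq (i + 1) (Finset.mem_Icc.mpr ⟨by omega, hiC⟩)
    have hab' : I (i + 1) = Finset.Ico a (b + 1) := by
      rw [hab]
      ext m
      simp only [Finset.mem_Icc, Finset.mem_Ico]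
      omega
    rw [hab', Nat.card_Ico] at hcard
    have hle := hI.last_eq_first i (Finset.mem_Icc.mpr ⟨hi, by omega⟩)
    have hs := start_add_le hK hi
    rw [ih, hab', lastMsgs_Ico (by omega), firstMsgs_Ico (by omega)] at hle
    -- equal nonempty intervals have the same left end
    have ha : a = start K P (i + 1) := by
      have h1 : a ∈ Finset.Ico a (a + P) := Finset.mem_Ico.mpr (by omega)
      have h2 : start K P (i + 1) ∈
          Finset.Ico (start K P (i + 1) + P - P) (start K P (i + 1) + P) :=
        Finset.mem_Ico.mpr (by omega)
      rw [← hle, Finset.mem_Ico] at h1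
      rw [hle, Finset.mem_Ico] at h2
      omega
    have hs' := start_succ (K := K) (P := P) (k := i + 1) (by omega) (by omega)
    rw [hab', ha]
    congr 1
    omega

theorem msgF_eq (hI : IsLPSFO M C K P I) (hP : 1 ≤ P) (hK : 2 * P ≤ K) {i j : ℕ}
    (hi : 1 ≤ i) (hiC : i ≤ C) (hj : 1 ≤ j) (hjP : j ≤ P) :
    msgF P I i j = start K P i + j - 1 := by
  have := start_add_le hK hi
  rw [msgF, hI.eq_Ico hP hK hi hiC, firstMsgs_Ico (by omega), nth_Ico hj (by omega)]

theorem msgL_eq (hI : IsLPSFO M C K P I) (hP : 1 ≤ P) (hK : 2 * P ≤ K) {i j : ℕ}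
    (hi : 1 ≤ i) (hiC : i ≤ C) (hj : 1 ≤ j) (hjP : j ≤ P) :
    msgL P I i j = start K P (i + 1) + j - 1 := by
  have := start_add_le hK hi
  rw [msgL, hI.eq_Ico hP hK hi hiC, lastMsgs_Ico (by omega), nth_Ico hj (by omega)]
  omega

theorem uniqueMsgs_eq (hI : IsLPSFO M C K P I) (hP : 1 ≤ P) (hK : 2 * P ≤ K) {i : ℕ}
    (hi : 2 ≤ i) (hiC : i ≤ C) :
    uniqueMsgs C I i = Finset.Ico (start K P i + P)
      (if i = C then start K P (i + 1) + P else start K P (i + 1)) := by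
  ext m
  simp only [uniqueMsgs, Finset.mem_sdiff, Finset.mem_biUnion, Finset.mem_erase, Finset.mem_Icc,
    not_exists, not_and, Finset.mem_Ico]
  rw [hI.eq_Ico hP hK (by omega) hiC, Finset.mem_Ico]
  have hs := start_add_le hK (show 1 ≤ i by omega)
  constructor
  · rintro ⟨⟨h1, h2⟩, h3⟩
    constructor
    · have := h3 (i - 1) ⟨by omega, by omega, by omega⟩
      rw [hI.eq_Ico hP hK (by omega) (by omega), Finset.mem_Ico,
        show i - 1 + 1 = i by omega] at this
      have : start K P (i - 1) ≤ start K P i := start_mono (by omega)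
      omega
    · split_ifs with hC
      · exact h2
      · have := h3 (i + 1) ⟨by omega, by omega, by omega⟩
        rw [hI.eq_Ico hP hK (by omega) (by omega), Finset.mem_Ico] at this
        have := start_add_le hK (show 1 ≤ i + 1 by omega)
        omega
  · rintro ⟨h1, h2⟩
    refine ⟨⟨by omega, by split_ifs at h2 <;> omega⟩, fun k hk => ?_⟩
    rw [hI.eq_Ico hP hK hk.2.1 hk.2.2, Finset.mem_Ico]
    rcases lt_or_gt_of_ne hk.1 with hki | hki
    · have : start K P (k + 1) ≤ start K P i := start_mono hki
      omega
    · have : start K P (i + 1) ≤ start K P k := start_mono hki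
      rw [if_neg (by omega)] at h2
      omega

theorem msgU_eq (hI : IsLPSFO M C K P I) (hP : 1 ≤ P) (hK : 2 * P ≤ K) {i j : ℕ}
    (hi : 2 ≤ i) (hiC : i ≤ C) (hj : 1 ≤ j) (hji : j < i) :
    msgU C I i j = start K P i + P + j - 1 := by
  have := start_add_le hK (show 1 ≤ i by omega)
  rw [msgU, uniqueMsgs_eq hI hP hK hi hiC, nth_Ico hj (by split_ifs <;> omega)]

theorem msgULast_eq (hI : IsLPSFO M C K P I) (hP : 1 ≤ P) (hK : 2 * P ≤ K) {i : ℕ}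
    (hi : 2 ≤ i) (hiC : i < C) : msgULast C I i = start K P (i + 1) - 1 := by
  have := start_add_le hK (show 1 ≤ i by omega)
  rw [msgULast, uniqueMsgs_eq hI hP hK hi hiC.le, if_neg hiC.ne, Nat.card_Ico,
    nth_Ico (by omega) (by omega)]
  omega

/-! ### Counting vertices -/

/-- The first `a k` messages of client `k`, together with its first `c k` unique messages
(for `2 ≤ k`). -/
def segment (K P : ℕ) (a c : ℕ → ℕ) (k : ℕ) : Finset ℕ :=
  Finset.Ico (start K P k) (start K P k + a k) ∪
    Finset.Ico (start K P k + P) (start K P k + P + c k)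

/-- The union of the segments of the clients `lo ≤ k < hi`. -/
def segments (K P : ℕ) (a c : ℕ → ℕ) (lo hi : ℕ) : Finset ℕ :=
  (Finset.Ico lo hi).biUnion (segment K P a c)

theorem mem_segment {a c : ℕ → ℕ} {k m : ℕ} : m ∈ segment K P a c k ↔
    (start K P k ≤ m ∧ m < start K P k + a k) ∨
      (start K P k + P ≤ m ∧ m < start K P k + P + c k) := by
  simp [segment]

theorem mem_segments {a c : ℕ → ℕ} {lo hi m : ℕ} : m ∈ segments K P a c lo hi ↔
    ∃ k, (lo ≤ k ∧ k < hi) ∧ m ∈ segment K P a c k := by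
  simp [segments]

/-- The segments are counted only under this condition, which makes each of them fit between the
first messages of consecutive clients. -/
def SegmentsFit (P : ℕ) (a c : ℕ → ℕ) (lo hi : ℕ) : Prop :=
  1 ≤ lo ∧ ∀ k, lo ≤ k → k < hi → a k ≤ P ∧ c k < k

theorem card_segment {a c : ℕ → ℕ} {k : ℕ} (h : a k ≤ P) :
    (segment K P a c k).card = a k + c k := by
  rw [segment, Finset.card_union_of_disjoint, Nat.card_Ico, Nat.card_Ico]
  · omega
  · rw [Finset.disjoint_left]
    intro m
    simp only [Finset.mem_Ico]
    omega

theorem lt_of_mem_segment {a c : ℕ → ℕ} {k m : ℕ} (hK : 2 * P ≤ K) (hk : 1 ≤ k)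
    (ha : a k ≤ P) (hc : c k < k) (hm : m ∈ segment K P a c k) :
    start K P k ≤ m ∧ m < start K P (k + 1) := by
  have := start_add_le hK hk
  rw [mem_segment] at hm
  omega

theorem card_inter_segment {a c : ℕ → ℕ} {i k : ℕ} (hI : IsLPSFO M C K P I) (hP : 1 ≤ P)
    (hK : 2 * P ≤ K) (hi : 1 ≤ i) (hiC : i ≤ C) (hk : 1 ≤ k) (ha : a k ≤ P) (hc : c k < k) :
    (segment K P a c k ∩ I i).card =
      (if k = i then a k + c k else 0) + (if k = i + 1 then a k else 0) := by
  rw [hI.eq_Ico hP hK hi hiC]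
  rcases lt_trichotomy k i with hki | rfl | hki
  · rw [if_neg (by omega), if_neg (by omega), Finset.card_eq_zero,
      ← Finset.disjoint_iff_inter_eq_empty, Finset.disjoint_left]
    intro m hm
    have := lt_of_mem_segment hK hk ha hc hm
    have : start K P (k + 1) ≤ start K P i := start_mono hki
    rw [Finset.mem_Ico]
    omega
  · rw [if_pos rfl, if_neg (by omega), add_zero, ← card_segment (K := K) ha,
      Finset.inter_eq_left.mpr]
    intro m hm
    have := lt_of_mem_segment hK hk ha hc hm
    rw [Finset.mem_Ico]
    omega
  · rcases Nat.lt_or_ge (i + 1) k with hki' | hki'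
    · rw [if_neg (by omega), if_neg (by omega), Finset.card_eq_zero,
        ← Finset.disjoint_iff_inter_eq_empty, Finset.disjoint_left]
      intro m hm
      have := lt_of_mem_segment hK hk ha hc hm
      have : start K P (i + 1 + 1) ≤ start K P k := start_mono hki'
      have := start_add_le hK (show 1 ≤ i + 1 by omega)
      rw [Finset.mem_Ico]
      omega
    · obtain rfl : k = i + 1 := by omega
      rw [if_neg (by omega), if_pos rfl, zero_add]
      have : segment K P a c (i + 1) ∩ Finset.Ico (start K P i) (start K P (i + 1) + P) =
          Finset.Ico (start K P (i + 1)) (start K P (i + 1) + a (i + 1)) := by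
        ext m
        have : start K P i ≤ start K P (i + 1) := start_mono (by omega)
        rw [Finset.mem_inter, mem_segment, Finset.mem_Ico, Finset.mem_Ico]
        omega
      rw [this, Nat.card_Ico]
      omega

theorem pairwiseDisjoint_segment {a c : ℕ → ℕ} {lo hi : ℕ} (hK : 2 * P ≤ K)
    (hfit : SegmentsFit P a c lo hi) :
    (Finset.Ico lo hi : Set ℕ).PairwiseDisjoint (segment K P a c) := by
  have key : ∀ k l, lo ≤ k → k < l → l < hi →
      Disjoint (segment K P a c k) (segment K P a c l) := by
    intro k l hk hkl hl
    rw [Finset.disjoint_left]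
    intro m hm hm'
    have hlo := hfit.1
    have h1 := hfit.2 k hk (by omega)
    have h2 := hfit.2 l (by omega) hl
    have := lt_of_mem_segment hK (by omega) h1.1 h1.2 hm
    have := lt_of_mem_segment hK (by omega) h2.1 h2.2 hm'
    have : start K P (k + 1) ≤ start K P l := start_mono hkl
    omega
  intro k hk l hl hkl
  simp only [Finset.coe_Ico, Set.mem_Ico] at hk hl
  rcases lt_or_gt_of_ne hkl with h | h
  · exact key k l hk.1 h hl.2
  · exact (key l k hl.1 h hk.2).symm

theorem card_segments {a c : ℕ → ℕ} {lo hi : ℕ} (hK : 2 * P ≤ K)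
    (hfit : SegmentsFit P a c lo hi) :
    (segments K P a c lo hi).card = ∑ k ∈ Finset.Ico lo hi, (a k + c k) := by
  rw [segments, Finset.card_biUnion (pairwiseDisjoint_segment hK hfit)]
  refine Finset.sum_congr rfl fun k hk => ?_
  rw [Finset.mem_Ico] at hk
  exact card_segment (hfit.2 k hk.1 hk.2).1

/-- A client holds its own segment and the overlap part of the next client's segment. -/
theorem card_segments_inter {a c : ℕ → ℕ} {lo hi i : ℕ} (hI : IsLPSFO M C K P I) (hP : 1 ≤ P)
    (hK : 2 * P ≤ K) (hfit : SegmentsFit P a c lo hi) (hi1 : 1 ≤ i) (hiC : i ≤ C) :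
    (segments K P a c lo hi ∩ I i).card =
      (if lo ≤ i ∧ i < hi then a i + c i else 0) +
        (if lo ≤ i + 1 ∧ i + 1 < hi then a (i + 1) else 0) := by
  rw [segments, Finset.biUnion_inter, Finset.card_biUnion]
  · calc _ = ∑ k ∈ Finset.Ico lo hi,
          ((if k = i then a k + c k else 0) + (if k = i + 1 then a k else 0)) := by
          refine Finset.sum_congr rfl fun k hk => ?_
          rw [Finset.mem_Ico] at hk
          have := hfit.1
          have h := hfit.2 k hk.1 hk.2
          exact card_inter_segment hI hP hK hi1 hiC (by omega) h.1 h.2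
      _ = _ := by
          rw [Finset.sum_add_distrib, Finset.sum_ite_eq', Finset.sum_ite_eq']
          simp only [Finset.mem_Ico]
  · intro k hk l hl hkl
    exact (pairwiseDisjoint_segment hK hfit hk hl hkl).mono Finset.inter_subset_left
      Finset.inter_subset_left

end Positions

/-! ### What a batch of transmissions teaches each client -/

/-- After the transmissions `W` alone, client `i` has learned exactly `c i` new messages. -/
def Learns (C : ℕ) (I : ℕ → Finset ℕ) (W : List Transmission) (c : ℕ → ℕ) : Prop :=
  ∀ i ∈ Finset.Icc 1 C, ∃ E : Finset ℕ, Disjoint E (I i) ∧ E.card = c i ∧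
    ∀ m, IsDetermined (I i) W m ↔ m ∈ I i ∨ m ∈ E

theorem learns_nil (C : ℕ) (I : ℕ → Finset ℕ) : Learns C I [] 0 :=
  fun _ _ => ⟨∅, by simp, rfl, fun m => by simp [isDetermined_nil]⟩

theorem Learns.append {C t : ℕ} {I : ℕ → Finset ℕ} {A B : List Transmission} {c c' : ℕ → ℕ}
    (h : Learns C I A c) (h' : Learns C I B c')
    (hA : ∀ w ∈ A, ∀ n ∈ w.terms, n < t) (hB : ∀ w ∈ B, ∀ n ∈ w.terms, t ≤ n) :
    Learns C I (A ++ B) (fun i => c i + c' i) := by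
  intro i hi
  obtain ⟨E, hE, hEc, hEA⟩ := h i hi
  obtain ⟨E', hE', hEc', hEB⟩ := h' i hi
  have hd : Disjoint E E' := by
    rw [Finset.disjoint_left]
    intro m hm hm'
    have hmI := Finset.disjoint_left.mp hE hm
    rcases ((hEA m).mpr (Or.inr hm)).mem_or_mem_terms with h1 | ⟨w, hw, hwm⟩
    · exact hmI h1
    rcases ((hEB m).mpr (Or.inr hm')).mem_or_mem_terms with h1 | ⟨w', hw', hwm'⟩
    · exact hmI h1
    exact absurd (hA w hw m hwm) (hB w' hw' m hwm').not_gt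
  refine ⟨E ∪ E', Finset.disjoint_union_left.mpr ⟨hE, hE'⟩, ?_, fun m => ?_⟩
  · rw [Finset.card_union_of_disjoint hd, hEc, hEc']
  · rw [isDetermined_append hA hB, hEA, hEB, Finset.mem_union]
    tauto

theorem learns_of_component {C : ℕ} {I : ℕ → Finset ℕ} {A : List Transmission} {V : Finset ℕ}
    {c : ℕ → ℕ} (act : ℕ → Prop)
    (hA : ∀ i ∈ Finset.Icc 1 C, ∀ m, IsDetermined (I i) A m ↔ m ∈ I i ∨ (m ∈ V ∧ act i))
    (hc : ∀ i ∈ Finset.Icc 1 C, act i → V.card = c i + (V ∩ I i).card)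
    (hc' : ∀ i ∈ Finset.Icc 1 C, ¬ act i → c i = 0) : Learns C I A c := by
  intro i hi
  by_cases hact : act i
  · refine ⟨V \ I i, Finset.sdiff_disjoint, ?_, fun m => ?_⟩
    · have := hc i hi hact
      have := Finset.card_sdiff_add_card_inter V (I i)
      omega
    · rw [hA i hi, Finset.mem_sdiff]
      tauto
  · refine ⟨∅, by simp, by simp [hc' i hi hact], fun m => ?_⟩
    rw [hA i hi]
    simp [hact]

theorem exists_mem_iff_card_inter_pos {V S : Finset ℕ} :
    (∃ v ∈ V, v ∈ S) ↔ 0 < (V ∩ S).card := by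
  simp [Finset.card_pos, Finset.Nonempty]

/-! ### The transmissions of a level in terms of positions -/

/-- The general case with `r = q + 3`, in terms of positions. -/
def generalList (s : ℕ → ℕ) (P o q d : ℕ) : List Transmission :=
  ((List.range q).flatMap fun i =>
      ⟨o + i + 2, [s (o + i + 2), s (o + i + 3)]⟩ ::
        (List.range i).map fun j => ⟨o + i + 2, [s (o + i + 2), s (o + i + 2) + P + j]⟩)
  ++ [⟨o + q + 2, [s (o + q + 2), s (o + q + 3)]⟩]
  ++ ((List.range d).map fun j => ⟨o + q + 2, [s (o + q + 2), s (o + q + 2) + P + j]⟩)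
  ++ ((List.range (q - d)).map fun j => ⟨o + q + 2, [s (o + q + 3), s (o + q + 3) + 1 + j]⟩)
  ++ ((List.range (d + 2)).map fun j => ⟨o + q + 3, [s (o + q + 3), s (o + q + 3) + P + j]⟩)

/-- The special case with `r = q + 4`, in terms of positions. -/
def specialList (s : ℕ → ℕ) (P o q : ℕ) : List Transmission :=
  [⟨o + 2, [s (o + 2), s (o + 2) + 1, s (o + 3)]⟩]
  ++ ((List.range q).flatMap fun i =>
      ⟨o + i + 3, [s (o + i + 3), s (o + i + 4)]⟩ ::
        (List.range i).map fun j => ⟨o + i + 3, [s (o + i + 3), s (o + i + 3) + P + j]⟩)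
  ++ [⟨o + q + 3, [s (o + q + 3), s (o + q + 4)]⟩]
  ++ ((List.range q).map fun j => ⟨o + q + 3, [s (o + q + 4), s (o + q + 3) + P + j]⟩)
  ++ ((List.range (q + 2)).map fun j => ⟨o + q + 4, [s (o + q + 4), s (o + q + 4) + P + j]⟩)

theorem upTo_eq_map (a b : ℕ) : upTo a b = (List.range (b + 1 - a)).map (a + ·) :=
  List.range'_eq_map_range

theorem sum_range_one_add (q : ℕ) : 2 * ∑ i ∈ Finset.range q, (1 + i) = q * (q + 1) := by
  induction q with
  | zero => rfl
  | succ q ih => rw [Finset.sum_range_succ, mul_add, ih]; ring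

theorem sum_map_range_add_one (q : ℕ) : 2 * ((List.range q).map (· + 1)).sum = q * (q + 1) := by
  induction q with
  | zero => rfl
  | succ q ih =>
    rw [List.range_succ, List.map_append, List.sum_append, mul_add, ih]
    simp only [List.map_cons, List.map_nil, List.sum_singleton]
    ring

theorem length_generalList {s : ℕ → ℕ} {P o q d T : ℕ} (hT : 2 * T = q * (q + 1)) (hd : d ≤ q) :
    (generalList s P o q d).length = q + 3 + T + d := by
  have := sum_map_range_add_one q
  simp only [generalList, List.length_append, List.length_flatMap, List.length_cons,
    List.length_map, List.length_range, List.length_nil]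
  omega

theorem length_specialList {s : ℕ → ℕ} {P o q T : ℕ} (hT : 2 * T = q * (q + 1)) :
    (specialList s P o q).length = T + 2 * q + 4 := by
  have := sum_map_range_add_one q
  simp only [specialList, List.length_append, List.length_flatMap, List.length_cons,
    List.length_map, List.length_range, List.length_nil]
  omega

theorem forall_mem_generalList {s : ℕ → ℕ} {P o q d : ℕ} {p : Transmission → Prop} :
    (∀ w ∈ generalList s P o q d, p w) ↔
      (∀ i < q, p ⟨o + i + 2, [s (o + i + 2), s (o + i + 3)]⟩ ∧
        ∀ j < i, p ⟨o + i + 2, [s (o + i + 2), s (o + i + 2) + P + j]⟩) ∧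
      p ⟨o + q + 2, [s (o + q + 2), s (o + q + 3)]⟩ ∧
      (∀ j < d, p ⟨o + q + 2, [s (o + q + 2), s (o + q + 2) + P + j]⟩) ∧
      (∀ j < q - d, p ⟨o + q + 2, [s (o + q + 3), s (o + q + 3) + 1 + j]⟩) ∧
      ∀ j < d + 2, p ⟨o + q + 3, [s (o + q + 3), s (o + q + 3) + P + j]⟩ := by
  simp only [generalList, List.forall_mem_append, List.forall_mem_flatMap, List.forall_mem_cons,
    List.forall_mem_map, List.mem_range, List.not_mem_nil, false_implies,
    implies_true, and_true, and_assoc]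

theorem forall_mem_specialList {s : ℕ → ℕ} {P o q : ℕ} {p : Transmission → Prop} :
    (∀ w ∈ specialList s P o q, p w) ↔
      p ⟨o + 2, [s (o + 2), s (o + 2) + 1, s (o + 3)]⟩ ∧
      (∀ i < q, p ⟨o + i + 3, [s (o + i + 3), s (o + i + 4)]⟩ ∧
        ∀ j < i, p ⟨o + i + 3, [s (o + i + 3), s (o + i + 3) + P + j]⟩) ∧
      p ⟨o + q + 3, [s (o + q + 3), s (o + q + 4)]⟩ ∧
      (∀ j < q, p ⟨o + q + 3, [s (o + q + 4), s (o + q + 3) + P + j]⟩) ∧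
      ∀ j < q + 2, p ⟨o + q + 4, [s (o + q + 4), s (o + q + 4) + P + j]⟩ := by
  simp only [specialList, List.forall_mem_append, List.forall_mem_flatMap, List.forall_mem_cons,
    List.forall_mem_map, List.mem_range, List.not_mem_nil, false_implies,
    implies_true, and_true, and_assoc]

section Levels

variable {M C K P : ℕ} {I : ℕ → Finset ℕ}

theorem generalCase_eq (hI : IsLPSFO M C K P I) (hK : 2 * P ≤ K) {o q d T : ℕ}
    (hT : 2 * T = q * (q + 1)) (hd : d ≤ q) (hqP : q + 1 ≤ P) (hC : o + q + 3 ≤ C) :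
    generalCase C P I o (q + 3 + T + d) (q + 3) = generalList (start K P) P o q d := by
  have hP : 1 ≤ P := by omega
  have e1 : (q + 3 - 2) * (q + 3 - 3) / 2 = T := by
    rw [show q + 3 - 2 = q + 1 by omega, show q + 3 - 3 = q by omega, mul_comm, ← hT]
    omega
  have e2 : q + 3 + T + d - (q + 3) - T = d := by omega
  simp only [generalCase, e1, e2, generalList, upTo_eq_map, List.flatMap_map, List.map_map,
    Function.comp_def]
  congr 1
  congr 1
  congr 1
  congr 1
  · rw [show q + 3 - 3 + 1 - 1 = q by omega]
    refine List.flatMap_congr fun i hi => ?_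
    rw [List.mem_range] at hi
    rw [show 1 + i - 1 + 1 - 1 = i by omega, show o + (1 + i + 1) = o + i + 2 by omega,
      msgF_eq hI hP hK (by omega) (by omega) le_rfl hP,
      msgL_eq hI hP hK (by omega) (by omega) le_rfl hP]
    refine congrArg₂ _ rfl (List.map_congr_left fun j hj => ?_)
    rw [List.mem_range] at hj
    rw [msgU_eq hI hP hK (by omega) (by omega) (by omega) (by omega)]
    congr 3
    omega
  · rw [show o + (q + 3 - 1) = o + q + 2 by omega,
      msgF_eq hI hP hK (by omega) (by omega) le_rfl hP,
      msgL_eq hI hP hK (by omega) (by omega) le_rfl hP]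
    rfl
  · rw [show d + 1 - 1 = d by omega]
    refine List.map_congr_left fun j hj => ?_
    rw [List.mem_range] at hj
    rw [show o + (q + 3 - 1) = o + q + 2 by omega,
      msgF_eq hI hP hK (by omega) (by omega) le_rfl hP,
      msgU_eq hI hP hK (by omega) (by omega) (by omega) (by omega)]
    congr 3
    omega
  · rw [show q + 3 - 3 + 1 - (d + 1) = q - d by omega]
    refine List.map_congr_left fun j hj => ?_
    rw [List.mem_range] at hj
    rw [show o + (q + 3 - 1) = o + q + 2 by omega,
      msgL_eq hI hP hK (by omega) (by omega) le_rfl hP,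
      msgL_eq hI hP hK (by omega) (by omega) (by omega) (by omega),
      show o + q + 2 + 1 = o + q + 3 from rfl]
    congr 3
    omega
  · rw [show d + 2 + 1 - 1 = d + 2 by omega]
    refine List.map_congr_left fun j hj => ?_
    rw [List.mem_range] at hj
    rw [show o + (q + 3) = o + q + 3 by omega,
      msgF_eq hI hP hK (by omega) (by omega) le_rfl hP,
      msgU_eq hI hP hK (by omega) (by omega) (by omega) (by omega)]
    congr 3
    omega

theorem specialCase_eq (hI : IsLPSFO M C K P I) (hK : 2 * P ≤ K) {o q T : ℕ}
    (hT : 2 * T = q * (q + 1)) (hqP : q + 2 ≤ P) (hC : o + q + 4 ≤ C) :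
    specialCase C P I o (T + 2 * q + 4) (q + 4) = specialList (start K P) P o q := by
  have hP : 1 ≤ P := by omega
  have e1 : (q + 4 - 3) * (q + 4 - 4) / 2 = T := by
    rw [show q + 4 - 3 = q + 1 by omega, show q + 4 - 4 = q by omega, mul_comm, ← hT]
    omega
  have e2 : T + 2 * q + 4 + 3 - (q + 4) - (T + 1) = q + 2 := by omega
  simp only [specialCase, e1, e2, specialList, upTo_eq_map, List.flatMap_map, List.map_map,
    Function.comp_def]
  congr 1
  congr 1
  congr 1
  congr 1
  · rw [msgF_eq hI hP hK (by omega) (by omega) le_rfl hP,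
      msgF_eq hI hP hK (by omega) (by omega) (by omega) (by omega),
      msgL_eq hI hP hK (by omega) (by omega) le_rfl hP]
    rfl
  · rw [show q + 4 - 4 + 1 - 1 = q by omega]
    refine List.flatMap_congr fun i hi => ?_
    rw [List.mem_range] at hi
    rw [show 1 + i - 1 + 1 - 1 = i by omega, show o + (1 + i + 2) = o + i + 3 by omega,
      msgF_eq hI hP hK (by omega) (by omega) le_rfl hP,
      msgL_eq hI hP hK (by omega) (by omega) le_rfl hP]
    refine congrArg₂ _ rfl (List.map_congr_left fun j hj => ?_)
    rw [List.mem_range] at hj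
    rw [msgU_eq hI hP hK (by omega) (by omega) (by omega) (by omega)]
    congr 3
    omega
  · rw [show o + (q + 4 - 1) = o + q + 3 by omega,
      msgF_eq hI hP hK (by omega) (by omega) le_rfl hP,
      msgL_eq hI hP hK (by omega) (by omega) le_rfl hP]
    rfl
  · rw [show q + 4 - 4 + 1 - 1 = q by omega]
    refine List.map_congr_left fun j hj => ?_
    rw [List.mem_range] at hj
    rw [show o + (q + 4 - 1) = o + q + 3 by omega,
      msgL_eq hI hP hK (by omega) (by omega) le_rfl hP,
      msgU_eq hI hP hK (by omega) (by omega) (by omega) (by omega)]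
    congr 3
    omega
  · rw [show q + 2 + 1 - 1 = q + 2 by omega]
    refine List.map_congr_left fun j hj => ?_
    rw [List.mem_range] at hj
    rw [show o + (q + 4) = o + q + 4 by omega,
      msgF_eq hI hP hK (by omega) (by omega) le_rfl hP,
      msgU_eq hI hP hK (by omega) (by omega) (by omega) (by omega)]
    congr 3
    omega

/-- A function is constant on `segments K P a c lo hi` if and only if it is constant along the path
through the first messages of the clients and along the star around each of them. -/
theorem constant_on_segments_iff {a c : ℕ → ℕ} {lo hi : ℕ} {f : ℕ → ZMod 2}
    (ha : ∀ k, lo ≤ k → k < hi → 1 ≤ a k) :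
    (∀ v ∈ segments K P a c lo hi, f v = f (start K P lo)) ↔
      (∀ k, lo ≤ k → k + 1 < hi → f (start K P k) = f (start K P (k + 1))) ∧
      ∀ k, lo ≤ k → k < hi →
        (∀ j < a k - 1, f (start K P k) = f (start K P k + 1 + j)) ∧
        (∀ j < c k, f (start K P k) = f (start K P k + P + j)) := by
  constructor
  · intro h
    have h1 : ∀ k, lo ≤ k → k < hi → ∀ j < a k,
        f (start K P k + j) = f (start K P lo) := fun k hk hk' j hj =>
      h _ (mem_segments.mpr ⟨k, ⟨hk, hk'⟩, mem_segment.mpr (Or.inl ⟨by omega, by omega⟩)⟩)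
    have h2 : ∀ k, lo ≤ k → k < hi → ∀ j < c k,
        f (start K P k + P + j) = f (start K P lo) := fun k hk hk' j hj =>
      h _ (mem_segments.mpr ⟨k, ⟨hk, hk'⟩, mem_segment.mpr (Or.inr ⟨by omega, by omega⟩)⟩)
    have h0 : ∀ k, lo ≤ k → k < hi → f (start K P k) = f (start K P lo) :=
      fun k hk hk' => h1 k hk hk' 0 (ha k hk hk')
    refine ⟨fun k hk hk' => ?_, fun k hk hk' => ⟨fun j hj => ?_, fun j hj => ?_⟩⟩
    · rw [h0 k hk (by omega), h0 (k + 1) (by omega) hk']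
    · rw [h0 k hk hk', add_assoc, h1 k hk hk' (1 + j) (by omega)]
    · rw [h0 k hk hk', h2 k hk hk' j hj]
  · rintro ⟨h1, h2⟩ v hv
    have h0 : ∀ k, lo ≤ k → k < hi → f (start K P k) = f (start K P lo) := by
      intro k hk
      induction k, hk using Nat.le_induction with
      | base => exact fun _ => rfl
      | succ k hk ih => exact fun hk' => by rw [← h1 k hk hk', ih (by omega)]
    obtain ⟨k, ⟨hk, hk'⟩, hv⟩ := mem_segments.mp hv
    rw [← h0 k hk hk']
    rcases mem_segment.mp hv with hv | hv
    · rcases eq_or_lt_of_le hv.1 with hv' | hv'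
      · rw [hv']
      · rw [(h2 k hk hk').1 (v - start K P k - 1) (by omega)]
        congr 1
        omega
    · rw [(h2 k hk hk').2 (v - start K P k - P) (by omega)]
      congr 1
      omega

theorem sum_pair_eq_zero_iff (f : ℕ → ZMod 2) (u v : ℕ) :
    (([u, v] : List ℕ).map f).sum = 0 ↔ f u = f v := by
  simp [CharTwo.add_eq_zero]

/-- The number of vertices in the overlap part of client `k`'s segment, in the general case: only
the last client of the level has more than one. -/
def generalA (o q d k : ℕ) : ℕ := if k = o + q + 3 then 1 + (q - d) else 1

/-- The number of vertices among client `k`'s unique messages, in the general case. -/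
def generalC (o q d k : ℕ) : ℕ :=
  if k = o + q + 3 then d + 2 else if k = o + q + 2 then d else k - (o + 2)

theorem generalList_constant_iff {o q d : ℕ} (f : ℕ → ZMod 2) :
    (∀ w ∈ generalList (start K P) P o q d, (w.terms.map f).sum = 0) ↔
      ∀ v ∈ segments K P (generalA o q d) (generalC o q d) (o + 2) (o + q + 4),
        f v = f (start K P (o + 2)) := by
  rw [constant_on_segments_iff (fun k _ _ => by unfold generalA; split_ifs <;> omega),
    forall_mem_generalList]
  simp only [sum_pair_eq_zero_iff]
  constructor
  · rintro ⟨h1, h2, h3, h4, h5⟩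
    refine ⟨fun k hk hk' => ?_, fun k hk hk' => ?_⟩
    · obtain ⟨i, rfl⟩ : ∃ i, k = o + i + 2 := ⟨k - o - 2, by omega⟩
      rcases Nat.lt_or_ge i q with hi | hi
      · exact (h1 i hi).1
      · obtain rfl : i = q := by omega
        exact h2
    · obtain ⟨i, rfl⟩ : ∃ i, k = o + i + 2 := ⟨k - o - 2, by omega⟩
      rcases Nat.lt_trichotomy i q with hi | rfl | hi
      · rw [generalA, generalC, if_neg (by omega), if_neg (by omega), if_neg (by omega)]
        refine ⟨fun j hj => by omega, fun j hj => (h1 i hi).2 j (by omega)⟩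
      · rw [generalA, generalC, if_neg (by omega), if_neg (by omega), if_pos rfl]
        exact ⟨fun j hj => by omega, h3⟩
      · obtain rfl : i = q + 1 := by omega
        rw [generalA, generalC, if_pos (by omega), if_pos (by omega)]
        exact ⟨fun j hj => h4 j (by omega), h5⟩
  · rintro ⟨h1, h2⟩
    refine ⟨fun i hi => ⟨h1 _ (by omega) (by omega), fun j hj => ?_⟩, h1 _ (by omega) (by omega),
      fun j hj => ?_, fun j hj => ?_, fun j hj => ?_⟩
    · refine (h2 (o + i + 2) (by omega) (by omega)).2 j ?_
      rw [generalC, if_neg (by omega), if_neg (by omega)]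
      omega
    · refine (h2 (o + q + 2) (by omega) (by omega)).2 j ?_
      rwa [generalC, if_neg (by omega), if_pos rfl]
    · refine (h2 (o + q + 3) (by omega) (by omega)).1 j ?_
      rw [generalA, if_pos rfl]
      omega
    · refine (h2 (o + q + 3) (by omega) (by omega)).2 j ?_
      rwa [generalC, if_pos rfl]

theorem sum_generalA_add_generalC {o q d T : ℕ} (hT : 2 * T = q * (q + 1)) (hd : d ≤ q) :
    ∑ k ∈ Finset.Ico (o + 2) (o + q + 4), (generalA o q d k + generalC o q d k) =
      q + 3 + T + d + 1 := by
  rw [Finset.sum_Ico_eq_sum_range, show o + q + 4 - (o + 2) = q + 1 + 1 by omega,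
    Finset.sum_range_succ, Finset.sum_range_succ]
  have h : ∑ i ∈ Finset.range q, (generalA o q d (o + 2 + i) + generalC o q d (o + 2 + i)) =
      ∑ i ∈ Finset.range q, (1 + i) := by
    refine Finset.sum_congr rfl fun i hi => ?_
    rw [Finset.mem_range] at hi
    rw [generalA, generalC, if_neg (by omega), if_neg (by omega), if_neg (by omega)]
    omega
  have := sum_range_one_add q
  rw [h, generalA, generalC, if_neg (by omega), if_neg (by omega), if_pos (by omega),
    generalA, generalC, if_pos (by omega), if_pos (by omega)]
  omega

theorem learns_generalList (hI : IsLPSFO M C K P I) (hK : 2 * P ≤ K) {o q d T : ℕ}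
    (hT : 2 * T = q * (q + 1)) (hd : d ≤ q) (hqP : q + 1 ≤ P) :
    Learns C I (generalList (start K P) P o q d)
      (fun i => if o < i ∧ i ≤ o + (q + 3) then o + (q + 3 + T + d) + 1 - i else 0) := by
  have hP : 1 ≤ P := by omega
  have hfit : SegmentsFit P (generalA o q d) (generalC o q d) (o + 2) (o + q + 4) :=
    ⟨by omega, fun k hk hk' => by
      unfold generalA generalC
      constructor <;> split_ifs <;> omega⟩
  have hcard := card_segments hK hfit
  rw [sum_generalA_add_generalC hT hd] at hcard
  have hinter : ∀ i ∈ Finset.Icc 1 C, (segments K P (generalA o q d) (generalC o q d) (o + 2)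
      (o + q + 4) ∩ I i).card = if o < i ∧ i ≤ o + (q + 3) then i - o else 0 := by
    intro i hi
    rw [Finset.mem_Icc] at hi
    rw [card_segments_inter hI hP hK hfit hi.1 hi.2]
    unfold generalA generalC
    split_ifs <;> omega
  refine learns_of_component _ (fun i _ => isDetermined_of_component
    (mem_segments.mpr ⟨o + 2, by omega, mem_segment.mpr (Or.inl ⟨le_rfl, ?_⟩)⟩)
    generalList_constant_iff) ?_ ?_
  · unfold generalA
    split_ifs <;> omega
  · intro i hi h
    rw [exists_mem_iff_card_inter_pos, hinter i hi] at h
    rw [hcard, hinter i hi]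
    split_ifs at h ⊢ <;> omega
  · intro i hi h
    rw [exists_mem_iff_card_inter_pos, hinter i hi] at h
    split_ifs at h ⊢ <;> omega

/-- The number of vertices among client `k`'s unique messages, in the special case. -/
def specialC (o q k : ℕ) : ℕ := if k = o + q + 4 then q + 2 else k - (o + 3)

theorem sum_triple_eq_zero_iff (f : ℕ → ZMod 2) (u v w : ℕ) :
    (([u, v, w] : List ℕ).map f).sum = 0 ↔ f u + f v = f w := by
  simp only [List.map_cons, List.map_nil, List.sum_cons, List.sum_nil, add_zero]
  rw [← add_assoc, CharTwo.add_eq_zero]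

theorem specialList_constant_iff {o q : ℕ} (f : ℕ → ZMod 2) :
    (∀ w ∈ specialList (start K P) P o q, (w.terms.map f).sum = 0) ↔
      (∀ v ∈ segments K P (fun _ => 1) (specialC o q) (o + 3) (o + q + 5),
        f v = f (start K P (o + 3))) ∧
      f (start K P (o + 2)) + f (start K P (o + 2) + 1) = f (start K P (o + 3)) := by
  rw [constant_on_segments_iff (fun _ _ _ => le_rfl), forall_mem_specialList]
  simp only [sum_pair_eq_zero_iff, sum_triple_eq_zero_iff]
  constructor
  · rintro ⟨h0, h1, h2, h3, h4⟩
    refine ⟨⟨fun k hk hk' => ?_, fun k hk hk' => ⟨fun j hj => by omega, ?_⟩⟩, h0⟩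
    · obtain ⟨i, rfl⟩ : ∃ i, k = o + i + 3 := ⟨k - o - 3, by omega⟩
      rcases Nat.lt_or_ge i q with hi | hi
      · exact (h1 i hi).1
      · obtain rfl : i = q := by omega
        exact h2
    · obtain ⟨i, rfl⟩ : ∃ i, k = o + i + 3 := ⟨k - o - 3, by omega⟩
      rcases Nat.lt_trichotomy i q with hi | rfl | hi
      · rw [specialC, if_neg (by omega)]
        exact fun j hj => (h1 i hi).2 j (by omega)
      · rw [specialC, if_neg (by omega)]
        exact fun j hj => h2.trans (h3 j (by omega))
      · obtain rfl : i = q + 1 := by omega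
        rw [specialC, if_pos (by omega)]
        exact h4
  · rintro ⟨⟨h1, h2⟩, h0⟩
    refine ⟨h0, fun i hi => ⟨h1 _ (by omega) (by omega), fun j hj => ?_⟩,
      h1 _ (by omega) (by omega), fun j hj => ?_, fun j hj => ?_⟩
    · refine (h2 (o + i + 3) (by omega) (by omega)).2 j ?_
      rw [specialC, if_neg (by omega)]
      omega
    · refine (h1 (o + q + 3) (by omega) (by omega)).symm.trans
        ((h2 (o + q + 3) (by omega) (by omega)).2 j ?_)
      rw [specialC, if_neg (by omega)]
      omega
    · refine (h2 (o + q + 4) (by omega) (by omega)).2 j ?_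
      rwa [specialC, if_pos rfl]

theorem sum_one_add_specialC {o q T : ℕ} (hT : 2 * T = q * (q + 1)) :
    ∑ k ∈ Finset.Ico (o + 3) (o + q + 5), (1 + specialC o q k) = T + 2 * q + 4 := by
  rw [Finset.sum_Ico_eq_sum_range, show o + q + 5 - (o + 3) = q + 1 + 1 by omega,
    Finset.sum_range_succ, Finset.sum_range_succ]
  have h : ∑ i ∈ Finset.range q, (1 + specialC o q (o + 3 + i)) =
      ∑ i ∈ Finset.range q, (1 + i) := by
    refine Finset.sum_congr rfl fun i hi => ?_
    rw [Finset.mem_range] at hi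
    rw [specialC, if_neg (by omega)]
    omega
  have := sum_range_one_add q
  rw [h, specialC, if_neg (by omega), specialC, if_pos (by omega)]
  omega

theorem learns_specialList (hI : IsLPSFO M C K P I) (hK : 2 * P ≤ K) {o q T : ℕ}
    (hT : 2 * T = q * (q + 1)) (hqP : q + 2 ≤ P) :
    Learns C I (specialList (start K P) P o q)
      (fun i => if o < i ∧ i ≤ o + (q + 4) then o + (T + 2 * q + 4) + 1 - i else 0) := by
  have hP : 1 ≤ P := by omega
  have hfit : SegmentsFit P (fun _ => 1) (specialC o q) (o + 3) (o + q + 5) :=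
    ⟨by omega, fun k hk hk' => by
      unfold specialC
      constructor
      · exact hP
      · split_ifs <;> omega⟩
  have hcard := card_segments hK hfit
  rw [sum_one_add_specialC hT] at hcard
  have hinter : ∀ i ∈ Finset.Icc 1 C, (segments K P (fun _ => 1) (specialC o q) (o + 3)
      (o + q + 5) ∩ I i).card = if o < i ∧ i ≤ o + (q + 4) then i - o - 1 else 0 := by
    intro i hi
    rw [Finset.mem_Icc] at hi
    rw [card_segments_inter hI hP hK hfit hi.1 hi.2]
    unfold specialC
    split_ifs <;> omega
  have hlo : start K P (o + 2) + P + (o + 2) ≤ start K P (o + 3) + 1 :=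
    start_add_le hK (by omega)
  have hnot : ∀ m, m < start K P (o + 3) →
      m ∉ segments K P (fun _ => 1) (specialC o q) (o + 3) (o + q + 5) := by
    intro m hm hm'
    obtain ⟨k, ⟨hk, hk'⟩, hm'⟩ := mem_segments.mp hm'
    have h := hfit.2 k hk hk'
    have := lt_of_mem_segment hK (by omega) h.1 h.2 hm'
    have : start K P (o + 3) ≤ start K P k := start_mono hk
    omega
  -- the two extra messages are held exactly by the first two clients of the level
  have hpair : ∀ i ∈ Finset.Icc 1 C, ∀ e ≤ 1,
      start K P (o + 2) + e ∈ I i ↔ i = o + 1 ∨ i = o + 2 := by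
    intro i hi e he
    rw [Finset.mem_Icc] at hi
    rw [hI.eq_Ico hP hK hi.1 hi.2, Finset.mem_Ico]
    have hi' := start_add_le hK hi.1
    constructor
    · rintro ⟨h1, h2⟩
      by_contra! hne
      rcases Nat.lt_or_ge i (o + 1) with h | h
      · have : start K P (i + 1) ≤ start K P (o + 1) := start_mono (by omega)
        have : start K P (o + 1) + P + (o + 1) ≤ start K P (o + 2) + 1 :=
          start_add_le hK (by omega)
        omega
      · have : start K P (o + 3) ≤ start K P i := start_mono (by omega)
        omega
    · rintro (rfl | rfl)
      · have : start K P (o + 1) ≤ start K P (o + 2) := start_mono (by omega)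
        rw [show o + 1 + 1 = o + 2 from rfl]
        omega
      · rw [show o + 2 + 1 = o + 3 from rfl]
        omega
  refine learns_of_component _ (fun i hi => isDetermined_of_component_pair
    (mem_segments.mpr ⟨o + 3, by omega, mem_segment.mpr (Or.inl ⟨le_rfl, by omega⟩)⟩)
    (hnot (start K P (o + 2)) (by omega)) (hnot (start K P (o + 2) + 1) (by omega)) (by omega)
    ((hpair i hi 0 (by omega)).trans (hpair i hi 1 le_rfl).symm)
    specialList_constant_iff) ?_ ?_
  · intro i hi h
    rw [exists_mem_iff_card_inter_pos, hinter i hi, ← add_zero (start K P (o + 2)),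
      hpair i hi 0 (by omega)] at h
    rw [hcard, hinter i hi]
    split_ifs at h ⊢ <;> omega
  · intro i hi h
    rw [exists_mem_iff_card_inter_pos, hinter i hi, ← add_zero (start K P (o + 2)),
      hpair i hi 0 (by omega)] at h
    split_ifs at h ⊢ <;> omega

end Levels

/-! ### The parameter `rMax` in terms of triangular numbers -/

theorem IsRMax.le_of_le {n n' r s : ℕ} (h : IsRMax n r) (h' : IsRMax n' s) (hn : n ≤ n') :
    r ≤ s := by
  by_contra! hlt
  obtain ⟨_, h1, _⟩ := h
  obtain ⟨hs, _, h2⟩ := h'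
  have hrs : (s : ℤ) + 1 ≤ r := by exact_mod_cast hlt
  have hs : (1 : ℤ) ≤ s := by exact_mod_cast hs
  have hn : (n : ℤ) ≤ n' := by exact_mod_cast hn
  have h3 : (s : ℤ) * (s - 1) / 2 ≤ ((r : ℤ) - 2) * (r - 1) / 2 :=
    Int.ediv_le_ediv (by norm_num) (by nlinarith)
  omega

theorem IsRMax.eq_rMax {n r : ℕ} (h : IsRMax n r) (hn : 0 < n) : rMax n = r :=
  le_antisymm ((rMax_spec hn).le_of_le h le_rfl) (h.le_of_le (rMax_spec hn) le_rfl)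

theorem isRMax_add_three_iff {n q T : ℕ} (hT : 2 * T = q * (q + 1)) :
    IsRMax n (q + 3) ↔ T + q + 1 < n ∧ n ≤ T + 2 * q + 3 := by
  have hT : 2 * (T : ℤ) = q * (q + 1) := by exact_mod_cast hT
  have e1 : (((q + 3 : ℕ) : ℤ) - 2) * (((q + 3 : ℕ) : ℤ) - 1) = 2 * (T + q + 1) := by
    push_cast
    linear_combination -hT
  have e2 : ((q + 3 : ℕ) : ℤ) * (((q + 3 : ℕ) : ℤ) - 1) = 2 * (T + 2 * q + 3) := by
    push_cast
    linear_combination -hT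
  rw [IsRMax, e1, e2, Int.mul_ediv_cancel_left _ two_ne_zero, Int.mul_ediv_cancel_left _ two_ne_zero]
  omega

theorem exists_triangular (q : ℕ) : ∃ T, 2 * T = q * (q + 1) := by
  obtain ⟨T, hT⟩ := Nat.even_mul_succ_self q
  exact ⟨T, by rw [hT]; ring⟩

/-- The two shapes of a level with `n ≥ 3` clients, with `T` the `q`-th triangular number. -/
theorem level_cases {n : ℕ} (hn : 3 ≤ n) :
    (∃ q T d, 2 * T = q * (q + 1) ∧ d ≤ q ∧ n = q + 3 + T + d ∧ rMax n = q + 3 ∧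
      n ≠ (rMax n - 2) * (rMax n - 1) / 2 + 1) ∨
    ∃ q T, 2 * T = q * (q + 1) ∧ n = T + 2 * q + 4 ∧ rMax n = q + 4 ∧
      n = (rMax n - 2) * (rMax n - 1) / 2 + 1 := by
  have hspec := rMax_spec (C := n) (by omega)
  have h3 : IsRMax 3 3 := by decide
  obtain ⟨q, hq⟩ := Nat.exists_eq_add_of_le' (h3.le_of_le hspec hn)
  obtain ⟨T, hT⟩ := exists_triangular q
  have e : (q + 3 - 2) * (q + 3 - 1) / 2 = T + q + 1 := by
    rw [show q + 3 - 2 = q + 1 by omega, show q + 3 - 1 = q + 2 by omega]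
    have : (q + 1) * (q + 2) = 2 * (T + q + 1) := by linear_combination -hT
    omega
  rw [hq, isRMax_add_three_iff hT] at hspec
  rw [hq, e]
  by_cases hs : n = T + q + 1 + 1
  · right
    obtain ⟨p, rfl⟩ : ∃ p, q = p + 1 := ⟨q - 1, by
      rcases q with _ | q
      · simp at hT; omega
      · omega⟩
    obtain ⟨T', hT'⟩ := exists_triangular p
    have : T = T' + p + 1 := by
      have : 2 * T = 2 * (T' + p + 1) := by linear_combination hT - hT'
      omega
    exact ⟨p, T', hT', by omega, rfl, hs⟩
  · left
    exact ⟨q, T, n - (T + q + 3), hT, by omega, by omega, rfl, hs⟩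

/-! ### The recursion -/

section Recursion

variable {M C K P : ℕ} {I : ℕ → Finset ℕ}

/-- The transmission `w` is made by a client that holds all its terms, and these lie between `lo`
and `hi`. -/
def IsPlaced (C : ℕ) (I : ℕ → Finset ℕ) (lo hi : ℕ) (w : Transmission) : Prop :=
  w.sender ∈ Finset.Icc 1 C ∧ ∀ m ∈ w.terms, m ∈ I w.sender ∧ lo ≤ m ∧ m < hi

theorem isPlaced_mk (hI : IsLPSFO M C K P I) (hP : 1 ≤ P) (hK : 2 * P ≤ K) {lo hi k : ℕ}
    {t : List ℕ} (hk : 1 ≤ k) (hkC : k ≤ C)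
    (ht : ∀ m ∈ t, (start K P k ≤ m ∧ m < start K P (k + 1) + P) ∧ lo ≤ m ∧ m < hi) :
    IsPlaced C I lo hi ⟨k, t⟩ :=
  ⟨Finset.mem_Icc.mpr ⟨hk, hkC⟩, fun m hm => by
    rw [hI.eq_Ico hP hK hk hkC, Finset.mem_Ico]
    exact ht m hm⟩

theorem generalList_isPlaced (hI : IsLPSFO M C K P I) (hK : 2 * P ≤ K) {o q d : ℕ}
    (hd : d ≤ q) (hqP : q + 1 ≤ P) (hC : o + q + 3 ≤ C) :
    ∀ w ∈ generalList (start K P) P o q d,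
      IsPlaced C I (start K P (o + 1) + P) (start K P (o + q + 3) + P + d + 2) w := by
  have hP : 1 ≤ P := by omega
  have h1 : start K P (o + 1) + P + (o + 1) ≤ start K P (o + 2) + 1 :=
    start_add_le hK (by omega)
  have h2 : start K P (o + q + 2) + P + (o + q + 2) ≤ start K P (o + q + 3) + 1 :=
    start_add_le hK (by omega)
  have h3 : start K P (o + q + 3) + P + (o + q + 3) ≤ start K P (o + q + 4) + 1 :=
    start_add_le hK (by omega)
  have h4 : start K P (o + 2) ≤ start K P (o + q + 2) := start_mono (by omega)
  rw [forall_mem_generalList]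
  refine ⟨fun i hi => ?_, ?_, fun j hj => ?_, fun j hj => ?_, fun j hj => ?_⟩
  · have h5 : start K P (o + i + 2) + P + (o + i + 2) ≤ start K P (o + i + 3) + 1 :=
      start_add_le hK (by omega)
    have h6 : start K P (o + i + 3) ≤ start K P (o + q + 2) := start_mono (by omega)
    have h7 : start K P (o + 2) ≤ start K P (o + i + 2) := start_mono (by omega)
    refine ⟨isPlaced_mk hI hP hK (by omega) (by omega) ?_,
      fun j hj => isPlaced_mk hI hP hK (by omega) (by omega) ?_⟩
    all_goals
      simp only [List.forall_mem_cons, List.not_mem_nil, false_implies, implies_true, and_true,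
        show o + i + 2 + 1 = o + i + 3 from rfl]
      omega
  · refine isPlaced_mk hI hP hK (by omega) (by omega) ?_
    simp only [List.forall_mem_cons, List.not_mem_nil, false_implies, implies_true, and_true,
      show o + q + 2 + 1 = o + q + 3 from rfl]
    omega
  · refine isPlaced_mk hI hP hK (by omega) (by omega) ?_
    simp only [List.forall_mem_cons, List.not_mem_nil, false_implies, implies_true, and_true,
      show o + q + 2 + 1 = o + q + 3 from rfl]
    omega
  · refine isPlaced_mk hI hP hK (by omega) (by omega) ?_
    simp only [List.forall_mem_cons, List.not_mem_nil, false_implies, implies_true, and_true,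
      show o + q + 2 + 1 = o + q + 3 from rfl]
    omega
  · refine isPlaced_mk hI hP hK (by omega) (by omega) ?_
    simp only [List.forall_mem_cons, List.not_mem_nil, false_implies, implies_true, and_true,
      show o + q + 3 + 1 = o + q + 4 from rfl]
    omega

theorem specialList_isPlaced (hI : IsLPSFO M C K P I) (hK : 2 * P ≤ K) {o q : ℕ}
    (hqP : q + 2 ≤ P) (hC : o + q + 4 ≤ C) :
    ∀ w ∈ specialList (start K P) P o q,
      IsPlaced C I (start K P (o + 1) + P) (start K P (o + q + 4) + P + q + 2) w := by
  have hP : 1 ≤ P := by omega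
  have h0 : start K P (o + 1) + P + (o + 1) ≤ start K P (o + 2) + 1 :=
    start_add_le hK (by omega)
  have h1 : start K P (o + 2) + P + (o + 2) ≤ start K P (o + 3) + 1 :=
    start_add_le hK (by omega)
  have h2 : start K P (o + q + 3) + P + (o + q + 3) ≤ start K P (o + q + 4) + 1 :=
    start_add_le hK (by omega)
  have h3 : start K P (o + q + 4) + P + (o + q + 4) ≤ start K P (o + q + 5) + 1 :=
    start_add_le hK (by omega)
  have h4 : start K P (o + 3) ≤ start K P (o + q + 3) := start_mono (by omega)
  rw [forall_mem_specialList]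
  refine ⟨?_, fun i hi => ?_, ?_, fun j hj => ?_, fun j hj => ?_⟩
  · refine isPlaced_mk hI hP hK (by omega) (by omega) ?_
    simp only [List.forall_mem_cons, List.not_mem_nil, false_implies, implies_true, and_true,
      show o + 2 + 1 = o + 3 from rfl]
    omega
  · have h5 : start K P (o + i + 3) + P + (o + i + 3) ≤ start K P (o + i + 4) + 1 :=
      start_add_le hK (by omega)
    have h6 : start K P (o + i + 4) ≤ start K P (o + q + 3) := start_mono (by omega)
    have h7 : start K P (o + 3) ≤ start K P (o + i + 3) := start_mono (by omega)
    refine ⟨isPlaced_mk hI hP hK (by omega) (by omega) ?_,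
      fun j hj => isPlaced_mk hI hP hK (by omega) (by omega) ?_⟩
    all_goals
      simp only [List.forall_mem_cons, List.not_mem_nil, false_implies, implies_true, and_true,
        show o + i + 3 + 1 = o + i + 4 from rfl]
      omega
  · refine isPlaced_mk hI hP hK (by omega) (by omega) ?_
    simp only [List.forall_mem_cons, List.not_mem_nil, false_implies, implies_true, and_true,
      show o + q + 3 + 1 = o + q + 4 from rfl]
    omega
  · refine isPlaced_mk hI hP hK (by omega) (by omega) ?_
    simp only [List.forall_mem_cons, List.not_mem_nil, false_implies, implies_true, and_true,
      show o + q + 3 + 1 = o + q + 4 from rfl]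
    omega
  · refine isPlaced_mk hI hP hK (by omega) (by omega) ?_
    simp only [List.forall_mem_cons, List.not_mem_nil, false_implies, implies_true, and_true,
      show o + q + 4 + 1 = o + q + 5 from rfl]
    omega

/-- The two-client level: client `o + 1` learns two messages and client `o + 2` learns one. -/
theorem learns_two (hI : IsLPSFO M C K P I) (hP : 1 ≤ P) (hK : 2 * P ≤ K) {o : ℕ} (ho : 1 ≤ o) :
    Learns C I
      [⟨o + 2, [start K P (o + 2), start K P (o + 2) + P]⟩,
       ⟨o + 2, [start K P (o + 2), start K P (o + 2) + P + 1]⟩,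
       ⟨o + 1, [start K P (o + 2), start K P (o + 1) + P]⟩]
      (fun i => if o < i ∧ i ≤ o + 2 then o + 3 - i else 0) := by
  set a : ℕ → ℕ := fun k => k - (o + 1) with ha
  set c : ℕ → ℕ := fun k => k - o with hc
  have hfit : SegmentsFit P a c (o + 1) (o + 3) :=
    ⟨by omega, fun k hk hk' => by constructor <;> simp only [ha, hc] <;> omega⟩
  have hcard := card_segments hK hfit
  rw [Finset.sum_Ico_eq_sum_range, show o + 3 - (o + 1) = 2 by omega, Finset.sum_range_succ,
    Finset.sum_range_one] at hcard
  have hV : segments K P a c (o + 1) (o + 3) = {start K P (o + 2), start K P (o + 2) + P,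
      start K P (o + 2) + P + 1, start K P (o + 1) + P} := by
    ext m
    have : (∃ k, (o + 1 ≤ k ∧ k < o + 3) ∧ m ∈ segment K P a c k) ↔
        m ∈ segment K P a c (o + 1) ∨ m ∈ segment K P a c (o + 2) := by
      constructor
      · rintro ⟨k, hk, hm⟩
        obtain rfl | rfl : k = o + 1 ∨ k = o + 2 := by omega
        · exact Or.inl hm
        · exact Or.inr hm
      · rintro (hm | hm)
        · exact ⟨o + 1, by omega, hm⟩
        · exact ⟨o + 2, by omega, hm⟩
    rw [mem_segments, this, mem_segment, mem_segment]
    simp only [ha, hc, Finset.mem_insert, Finset.mem_singleton]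
    omega
  have hinter : ∀ i ∈ Finset.Icc 1 C, (segments K P a c (o + 1) (o + 3) ∩ I i).card =
      if o < i ∧ i ≤ o + 2 then i - o + 1 else 0 := by
    intro i hi
    rw [Finset.mem_Icc] at hi
    rw [card_segments_inter hI hP hK hfit hi.1 hi.2]
    simp only [ha, hc]
    split_ifs <;> omega
  refine learns_of_component _ (fun i _ => isDetermined_of_component
    (V := segments K P a c (o + 1) (o + 3)) (ρ := start K P (o + 2)) ?_ fun f => ?_) ?_ ?_
  · simp [hV]
  · rw [hV]
    simp only [List.forall_mem_cons, sum_pair_eq_zero_iff, List.not_mem_nil, false_implies,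
      implies_true, and_true, Finset.mem_insert, Finset.mem_singleton, forall_eq_or_imp, forall_eq,
      true_and]
    simp only [eq_comm]
  · intro i hi h
    rw [exists_mem_iff_card_inter_pos, hinter i hi] at h
    rw [hcard, hinter i hi]
    simp only [ha, hc]
    split_ifs at h ⊢ <;> omega
  · intro i hi h
    rw [exists_mem_iff_card_inter_pos, hinter i hi] at h
    split_ifs at h ⊢ <;> omega

/-- The one-client level: the transmission of client `o` about its last unique message teaches
client `o + 1` one message and nobody else anything. -/
theorem learns_one (hI : IsLPSFO M C K P I) (hP : 1 ≤ P) (hK : 2 * P ≤ K) {o : ℕ} (ho : 2 ≤ o) :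
    Learns C I [⟨o, [start K P (o + 1), start K P (o + 1) - 1]⟩]
      (fun i => if i = o + 1 then 1 else 0) := by
  have h0 := start_add_le hK (show 1 ≤ o by omega)
  have h1 : start K P (o + 1) + P + (o + 1) ≤ start K P (o + 2) + 1 :=
    start_add_le hK (by omega)
  have hmem : ∀ i ∈ Finset.Icc 1 C,
      (start K P (o + 1) ∈ I i ↔ i = o ∨ i = o + 1) ∧ (start K P (o + 1) - 1 ∈ I i ↔ i = o) := by
    intro i hi
    rw [Finset.mem_Icc] at hi
    rw [hI.eq_Ico hP hK hi.1 hi.2, Finset.mem_Ico, Finset.mem_Ico]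
    rcases Nat.lt_trichotomy i o with h | rfl | h
    · have : start K P (i + 1) ≤ start K P o := start_mono h
      omega
    · omega
    · obtain rfl | h : i = o + 1 ∨ o + 2 ≤ i := by omega
      · rw [show o + 1 + 1 = o + 2 from rfl]
        omega
      · have : start K P (o + 2) ≤ start K P i := start_mono h
        omega
  refine learns_of_component _ (fun i _ => isDetermined_of_component
    (V := {start K P (o + 1), start K P (o + 1) - 1}) (ρ := start K P (o + 1)) ?_ fun f => ?_) ?_ ?_
  · simp
  · simp only [List.forall_mem_cons, sum_pair_eq_zero_iff, List.not_mem_nil, false_implies,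
      implies_true, and_true, Finset.mem_insert, Finset.mem_singleton, forall_eq_or_imp, forall_eq,
      true_and]
    exact eq_comm
  · intro i hi h
    obtain ⟨e1, e2⟩ := hmem i hi
    have hne : start K P (o + 1) ≠ start K P (o + 1) - 1 := by omega
    rw [Finset.card_pair hne]
    by_cases hio : i = o
    · rw [if_neg (by omega), Finset.inter_eq_left.mpr, Finset.card_pair hne]
      intro m hm
      rw [Finset.mem_insert, Finset.mem_singleton] at hm
      rcases hm with rfl | rfl
      · exact e1.mpr (Or.inl hio)
      · exact e2.mpr hio
    · have hio' : i = o + 1 := by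
        obtain ⟨v, hv, hvI⟩ := h
        rw [Finset.mem_insert, Finset.mem_singleton] at hv
        rcases hv with rfl | rfl
        · exact (e1.mp hvI).resolve_left hio
        · exact absurd (e2.mp hvI) hio
      rw [if_pos hio', Finset.insert_inter_of_mem (e1.mpr (Or.inr hio')),
        Finset.singleton_inter_of_notMem (fun h => hio (e2.mp h))]
      rfl
  · intro i hi h
    refine if_neg fun hio => h ⟨start K P (o + 1), by simp, (hmem i hi).1.mpr (Or.inr hio)⟩

theorem Learns.congr {W : List Transmission} {c c' : ℕ → ℕ} (h : Learns C I W c)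
    (hc : ∀ i ∈ Finset.Icc 1 C, c i = c' i) : Learns C I W c' := by
  intro i hi
  obtain ⟨E, h1, h2, h3⟩ := h i hi
  exact ⟨E, h1, h2.trans (hc i hi), h3⟩

/-- A lower bound for the messages that the levels from client `o + 1` on deal with. If only one
client is left, then its predecessor's last unique message is among them. -/
def lowerBound (K P o n : ℕ) : ℕ :=
  if n = 1 then start K P (o + 1) - 1 else start K P (o + 1) + P

theorem numTransmissions_of_three_le {n : ℕ} (hn : 3 ≤ n) :
    numTransmissions n = n + numTransmissions (n - rMax n) := by
  rw [numTransmissions, dif_pos (by omega)]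

theorem numTransmissions_of_le_two :
    numTransmissions 0 = 0 ∧ numTransmissions 1 = 1 ∧ numTransmissions 2 = 3 := by
  refine ⟨?_, ?_, ?_⟩ <;> rw [numTransmissions] <;> simp

/-- The properties of the levels from client `o + 1` on that the induction carries. Every one of
the clients handled by them learns just enough to end up with `K + C` messages. -/
structure TailSpec (C K P : ℕ) (I : ℕ → Finset ℕ) (o n : ℕ) (W : List Transmission) : Prop where
  decentralized : IsDecentralized C I W
  lowerBound_le : ∀ w ∈ W, ∀ m ∈ w.terms, lowerBound K P o n ≤ m
  learns : Learns C I W (fun i => if o < i then C + 1 - i else 0)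
  length_eq : W.length = numTransmissions n

/-- A level is put in front of the levels after it, with which it shares no message. -/
theorem TailSpec.append {A W : List Transmission} {o n r hi : ℕ} (hK : 2 * P ≤ K) (hn : 3 ≤ n)
    (hC : o + n = C) (hr : rMax n = r) (hr2 : 2 ≤ r)
    (hAp : ∀ w ∈ A, IsPlaced C I (start K P (o + 1) + P) hi w)
    (hhi : hi ≤ lowerBound K P (o + r) (n - r))
    (hAl : Learns C I A (fun i => if o < i ∧ i ≤ o + r then o + n + 1 - i else 0))
    (hAn : A.length = n) (hW : TailSpec C K P I (o + r) (n - r) W) :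
    TailSpec C K P I o n (A ++ W) := by
  have hlo : start K P (o + 1) + P ≤ lowerBound K P (o + r) (n - r) := by
    have h1 : start K P (o + 1) + P + (o + 1) ≤ start K P (o + 2) + 1 :=
      start_add_le hK (by omega)
    have h2 : start K P (o + 2) + P + (o + 2) ≤ start K P (o + 3) + 1 :=
      start_add_le hK (by omega)
    have h3 : start K P (o + 3) ≤ start K P (o + r + 1) := start_mono (by omega)
    unfold lowerBound
    split_ifs <;> omega
  refine ⟨?_, ?_, ?_, ?_⟩
  · intro w hw
    rcases List.mem_append.mp hw with hw | hw
    · exact ⟨(hAp w hw).1, fun m hm => ((hAp w hw).2 m hm).1⟩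
    · exact hW.decentralized w hw
  · intro w hw m hm
    rw [lowerBound, if_neg (by omega)]
    rcases List.mem_append.mp hw with hw | hw
    · exact ((hAp w hw).2 m hm).2.1
    · exact hlo.trans (hW.lowerBound_le w hw m hm)
  · refine (hAl.append hW.learns (t := lowerBound K P (o + r) (n - r))
      (fun w hw m hm => ((hAp w hw).2 m hm).2.2.trans_le hhi) hW.lowerBound_le).congr ?_
    intro i hi
    rw [Finset.mem_Icc] at hi
    split_ifs <;> omega
  · rw [List.length_append, hAn, hW.length_eq, numTransmissions_of_three_le hn, hr]

theorem tailSpec_schemeFrom (hI : IsLPSFO M C K P I) (hP : 1 ≤ P) (hK : 2 * P ≤ K) (hC3 : 3 ≤ C)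
    (n : ℕ) : ∀ o, o + n = C → (∀ s, IsRMax n s → s - 2 ≤ P) →
      TailSpec C K P I o n (schemeFrom C P I o n) := by
  induction n using Nat.strong_induction_on with
  | _ n ih =>
  intro o hC hr
  obtain hn | rfl | rfl | rfl : 3 ≤ n ∨ n = 2 ∨ n = 1 ∨ n = 0 := by omega
  · have hspec := rMax_spec (C := n) (by omega)
    have hrP := hr _ hspec
    -- the parameter of the next level is no larger, so that `P` stays large enough
    have ih' : rMax n ≤ n → TailSpec C K P I (o + rMax n) (n - rMax n)
        (schemeFrom C P I (o + rMax n) (n - rMax n)) := by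
      intro hle
      refine ih _ (by have := hspec.1; omega) _ (by omega) fun s hs => ?_
      have := hs.le_of_le hspec (Nat.sub_le _ _)
      omega
    rw [schemeFrom, dif_pos (by omega)]
    rcases level_cases hn with ⟨q, T, d, hT, hd, hnq, hrq, hne⟩ | ⟨q, T, hT, hnq, hrq, hne⟩
    · rw [if_pos hne]
      rw [hrq] at ih' hrP ⊢
      rw [show generalCase C P I o n (q + 3) = generalList (start K P) P o q d by
        rw [hnq]; exact generalCase_eq hI hK hT hd (by omega) (by omega)]
      refine TailSpec.append hK hn hC hrq (by omega)
        (generalList_isPlaced hI hK hd (by omega) (by omega)) ?_ ?_ ?_ (ih' (by omega))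
      · have h3 : start K P (o + q + 3) + P + (o + q + 3) ≤ start K P (o + q + 4) + 1 :=
          start_add_le hK (by omega)
        rw [lowerBound, show o + (q + 3) + 1 = o + q + 4 by omega]
        split_ifs with h1
        · -- a single client remains only for five clients, where `q = 1` and `d = 0`
          have hq : q ≠ 0 := by
            rintro rfl
            omega
          have hTq : 2 * T ≥ 2 * q := by
            rw [hT]
            nlinarith [Nat.pos_of_ne_zero hq]
          omega
        · omega
      · rw [hnq]
        exact learns_generalList hI hK hT hd (by omega)
      · rw [hnq]
        exact length_generalList hT hd
    · rw [if_neg (not_not.mpr hne)]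
      rw [hrq] at ih' hrP ⊢
      rw [show specialCase C P I o n (q + 4) = specialList (start K P) P o q by
        rw [hnq]; exact specialCase_eq hI hK hT (by omega) (by omega)]
      refine TailSpec.append hK hn hC hrq (by omega)
        (specialList_isPlaced hI hK (by omega) (by omega)) ?_ ?_ ?_ (ih' (by omega))
      · have h3 : start K P (o + q + 4) + P + (o + q + 4) ≤ start K P (o + q + 5) + 1 :=
          start_add_le hK (by omega)
        rw [lowerBound, show o + (q + 4) + 1 = o + q + 5 by omega]
        split_ifs <;> omega
      · rw [hnq]
        exact learns_specialList hI hK hT (by omega)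
      · rw [hnq]
        exact length_specialList hT
  · rw [schemeFrom, dif_neg (by omega), if_pos rfl,
      msgF_eq hI hP hK (by omega) (by omega) le_rfl hP,
      msgU_eq hI hP hK (by omega) (by omega) le_rfl (by omega),
      msgU_eq hI hP hK (by omega) (by omega) (by omega) (by omega),
      msgL_eq hI hP hK (by omega) (by omega) le_rfl hP,
      msgU_eq hI hP hK (by omega) (by omega) le_rfl (by omega)]
    have h1 : start K P (o + 1) + P + (o + 1) ≤ start K P (o + 2) + 1 :=
      start_add_le hK (by omega)
    have h2 : start K P (o + 2) + P + (o + 2) ≤ start K P (o + 3) + 1 :=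
      start_add_le hK (by omega)
    have hplaced : ∀ w ∈ ([⟨o + 2, [start K P (o + 2), start K P (o + 2) + P]⟩,
        ⟨o + 2, [start K P (o + 2), start K P (o + 2) + P + 1]⟩,
        ⟨o + 1, [start K P (o + 2), start K P (o + 1) + P]⟩] : List Transmission),
        IsPlaced C I (start K P (o + 1) + P) (start K P (o + 3)) w := by
      simp only [List.forall_mem_cons, List.not_mem_nil, false_implies, implies_true, and_true]
      refine ⟨?_, ?_, ?_⟩ <;> refine isPlaced_mk hI hP hK (by omega) (by omega) ?_ <;>
        simp only [List.forall_mem_cons, List.not_mem_nil, false_implies, implies_true, and_true,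
          show o + 1 + 1 = o + 2 from rfl, show o + 2 + 1 = o + 3 from rfl] <;> omega
    refine ⟨fun w hw => ⟨(hplaced w hw).1, fun m hm => ((hplaced w hw).2 m hm).1⟩,
      fun w hw m hm => ?_, (learns_two hI hP hK (by omega)).congr fun i hi => ?_, ?_⟩
    · rw [lowerBound, if_neg (by omega)]
      exact ((hplaced w hw).2 m hm).2.1
    · rw [Finset.mem_Icc] at hi
      split_ifs <;> omega
    · rw [numTransmissions_of_le_two.2.2]
      rfl
  · rw [schemeFrom, dif_neg (by omega), if_neg (by omega), if_pos rfl,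
      show C - 1 = o by omega,
      msgL_eq hI hP hK (by omega) (by omega) le_rfl hP,
      msgULast_eq hI hP hK (by omega) (by omega)]
    have h1 : start K P o + P + o ≤ start K P (o + 1) + 1 := start_add_le hK (by omega)
    have hplaced : ∀ w ∈ ([⟨o, [start K P (o + 1), start K P (o + 1) - 1]⟩] : List Transmission),
        IsPlaced C I (start K P (o + 1) - 1) (start K P (o + 1) + 1) w := by
      simp only [List.forall_mem_cons, List.not_mem_nil, false_implies, implies_true, and_true]
      refine isPlaced_mk hI hP hK (by omega) (by omega) ?_
      simp only [List.forall_mem_cons, List.not_mem_nil, false_implies, implies_true, and_true]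
      omega
    refine ⟨fun w hw => ⟨(hplaced w hw).1, fun m hm => ((hplaced w hw).2 m hm).1⟩,
      fun w hw m hm => ?_, (learns_one hI hP hK (by omega)).congr fun i hi => ?_, ?_⟩
    · rw [lowerBound, if_pos rfl]
      exact ((hplaced w hw).2 m hm).2.1
    · rw [Finset.mem_Icc] at hi
      split_ifs <;> omega
    · rw [numTransmissions_of_le_two.2.1]
      rfl
  · rw [schemeFrom, dif_neg (by omega), if_neg (by omega), if_neg (by omega)]
    refine ⟨by simp [IsDecentralized], by simp, (learns_nil C I).congr fun i hi => ?_, ?_⟩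
    · rw [Finset.mem_Icc] at hi
      rw [if_neg (by omega)]
      rfl
    · rw [numTransmissions_of_le_two.1]
      rfl

theorem isSecure_of_learns {b : ℕ} {W : List Transmission} (hI : IsLPSFO M C K P I) (hb : 0 < b)
    (hW : IsDecentralized C I W) (h : Learns C I W (fun i => C + 1 - i)) :
    IsSecure b M C (K + C) I W := by
  intro i hi
  obtain ⟨E, hE, hEc, hEW⟩ := h i hi
  have : finalKnowledge b M (I i) W = ((I i ∪ E : Finset ℕ) : Set ℕ) := by
    ext m
    rw [finalKnowledge, Set.mem_ofPred_eq, canDecode_iff_isDetermined hb, Finset.mem_coe,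
      Finset.mem_union, ← hEW]
    refine and_iff_right_of_imp fun hm => ?_
    rcases hm.mem_or_mem_terms with hm | ⟨w, hw, hm⟩
    · exact hI.subset_messages i hi hm
    · exact hI.subset_messages _ (hW w hw).1 ((hW w hw).2 m hm)
  rw [this, Set.ncard_coe_finset, Finset.card_union_of_disjoint hE.symm, hI.card_eq i hi, hEc]
  rw [Finset.mem_Icc] at hi
  dsimp only
  omega

end Recursion

end SecureDPIC

theorem theorem2 (M C K P r b : ℕ) (I : ℕ → Finset ℕ)
    (hI : SecureDPIC.IsLPSFO M C K P I)
    (hb : 0 < b) (hC : 3 ≤ C) (hr : SecureDPIC.IsRMax C r)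
    (hK : 2 * P ≤ K) (hP : r - 2 ≤ P) :
    -- every transmission uses only messages that its sender holds as side information
    SecureDPIC.IsDecentralized C I (SecureDPIC.scheme C P I) ∧
    -- every client ends up with exactly `K + C` messages
    SecureDPIC.IsSecure b M C (K + C) I (SecureDPIC.scheme C P I) ∧
    -- the number of transmissions is `N(C)`
    (SecureDPIC.scheme C P I).length = SecureDPIC.numTransmissions C ∧
    SecureDPIC.numTransmissions C = C + SecureDPIC.numTransmissions (C - r) ∧
    (∀ n s : ℕ, 3 ≤ n → SecureDPIC.IsRMax n s →
      SecureDPIC.numTransmissions n = n + SecureDPIC.numTransmissions (n - s)) ∧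
    SecureDPIC.numTransmissions 0 = 0 ∧
    SecureDPIC.numTransmissions 1 = 1 ∧
    SecureDPIC.numTransmissions 2 = 3 := by
  have h3 : SecureDPIC.IsRMax 3 3 := by decide
  have hr3 := h3.le_of_le hr hC
  have hspec := SecureDPIC.tailSpec_schemeFrom hI (by omega) hK hC C 0 (by omega) fun s hs => by
    have := hs.le_of_le hr le_rfl
    omega
  have hrec : ∀ n s : ℕ, 3 ≤ n → SecureDPIC.IsRMax n s →
      SecureDPIC.numTransmissions n = n + SecureDPIC.numTransmissions (n - s) := by
    intro n s hn hs
    rw [SecureDPIC.numTransmissions_of_three_le hn, hs.eq_rMax (by omega)]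
  refine ⟨hspec.decentralized,
    SecureDPIC.isSecure_of_learns hI hb hspec.decentralized (hspec.learns.congr fun i hi => ?_),
    hspec.length_eq, hrec C r hC hr, hrec, SecureDPIC.numTransmissions_of_le_two⟩
  rw [Finset.mem_Icc] at hi
  exact if_pos (by omega)
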